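/- Let $d\ge 1$ and let $\rho\ge 0$ be a probability density on $\mathbb R$ that is (essentially) bounded and has compact support. Let $\omega=(\omega_n)_{n\in\mathbb Z^d}$ be independent real random variables on a probability space $(\Omega,\mathcal A,\mathbb P)$, each with distribution $\rho(v)\,dv$, and let $\mathbb E$ denote expectation. On $\ell^2(\mathbb Z^d)$, with canonical basis $(e_x)_{x\in\mathbb Z^d}$, consider the Anderson Hamiltonian $$(h_\omega u)(n) = -\sum_{k\in\mathbb Z^d,\ |k|=1} u(n+k) + \omega_n u(n),\qquad |k|=|k_1|+\dots+|k_d|,$$ which is almost surely a bounded self-adjoint operator. For $x,y\in\mathbb Z^d$ let $\mu_{x,y}$ be its mixed spectral measure, i.e. the complex Borel measure $\mu_{x,y}(B)=\langle e_x,\chi_B(h_\omega)e_y\rangle$ on $\mathbb R$, and let $|\mu_{x,y}|$ be its total variation. For $L\in\mathbb N$ let $\Lambda_L=[-L,L]^d\cap\mathbb Z^d$, let $h_\omega^{\Lambda_L}$ be the restriction of $h_\omega$ to $\ell^2(\Lambda_L)$ (i.e. its matrix is $(\langle e_n,h_\omega e_m\rangle)_{n,m\in\Lambda_L}$), and for $x,y\in\Lambda_L$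 let $G_\omega^{\Lambda_L}(x,y;E)=\langle e_x,(h_\omega^{\Lambda_L}-E)^{-1}e_y\rangle$ be its Green function, defined for all real $E$ outside the finite spectrum of $h_\omega^{\Lambda_L}$. **Proposition.** Let $0<s<1$. There is a constant $C=C(s,\rho,d)<\infty$ such that for every bounded open interval $I\subset\mathbb R$ and all $x,y\in\mathbb Z^d$ the function $\omega\mapsto|\mu_{x,y}|(I)$ is measurable (up to modification on a null set) and $$\mathbb E\big(|\mu_{x,y}|(I)\big)\ \le\ C\,\liminf_{L\to\infty}\left(\int_I \mathbb E\big(|G_\omega^{\Lambda_L}(x,y;E)|^s\big)\,dE\right)^{\frac1{2-s}} .$$ -/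

import Mathlib

open MeasureTheory ProbabilityTheory Filter Topology
open scoped ENNReal NNReal CompactlySupported

noncomputable section

/-! ### Spectral measures of a bounded self-adjoint operator -/

section Spectral

variable {H : Type*} [NormedAddCommGroup H] [InnerProductSpace ℂ H] [CompleteSpace H]

/-- The positive linear functional `f ↦ ⟨ψ, f(T) ψ⟩` on real continuous compactly supported
functions, where `f(T)` is given by the continuous functional calculus of the self-adjoint
operator `T`. -/
def spectralFunctional (T : H →L[ℂ] H) (ψ : H) : C_c(ℝ, ℝ) →ₚ[ℝ] ℝ :=
  PositiveLinearMap.mk₀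
    { toFun := fun f => (inner ℂ ψ (cfc (fun t : ℝ => f t) T ψ)).re
      map_add' := by
        intro f g
        have h := cfc_add (R := ℝ) (a := T) (fun t => f t) (fun t => g t)
          f.continuous.continuousOn g.continuous.continuousOn
        have h' : (fun t : ℝ => (f + g) t) = fun t => f t + g t := rfl
        rw [h', h, add_apply, inner_add_right, Complex.add_re]
      map_smul' := by
        intro c f
        have h := cfc_smul (R := ℝ) (a := T) c (fun t => f t) f.continuous.continuousOn
        have h' : (fun t : ℝ => (c • f) t) = fun t => c • f t := rfl
        rw [h', h, smul_apply, inner_smul_right_eq_smul, Complex.smul_re]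
        rfl }
    (by
      intro f hf
      have h : (0 : H →L[ℂ] H) ≤ cfc (fun t : ℝ => f t) T := cfc_nonneg fun t _ => hf t
      exact ((ContinuousLinearMap.nonneg_iff_isPositive _).1 h).re_inner_nonneg_right ψ)

/-- The spectral measure of the self-adjoint operator `T` at the vector `ψ`: the Borel measure on
`ℝ` with `∫ f dμ = ⟨ψ, f(T) ψ⟩` for all `f ∈ C_c(ℝ)`, i.e. `μ(B) = ⟨ψ, χ_B(T) ψ⟩`. -/
def spectralMeasure (T : H →L[ℂ] H) (ψ : H) : Measure ℝ :=
  RealRMK.rieszMeasure (spectralFunctional T ψ)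

theorem integral_spectralMeasure (T : H →L[ℂ] H) (ψ : H) (f : C_c(ℝ, ℝ)) :
    ∫ t, f t ∂(spectralMeasure T ψ) = (inner ℂ ψ (cfc (fun t : ℝ => f t) T ψ)).re :=
  RealRMK.integral_rieszMeasure (spectralFunctional T ψ) f

theorem spectralFunctional_le (T : H →L[ℂ] H) (ψ : H) (f : C_c(ℝ, ℝ)) (hf : ∀ t, f t ≤ 1)
    (hf' : ∀ t, 0 ≤ f t) : spectralFunctional T ψ f ≤ ‖ψ‖ ^ 2 := by
  have h1 : ‖cfc (fun t : ℝ => f t) T‖ ≤ 1 :=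
    norm_cfc_le zero_le_one fun t _ => by
      rw [Real.norm_of_nonneg (hf' t)]; exact hf t
  calc (inner ℂ ψ (cfc (fun t : ℝ => f t) T ψ)).re
      ≤ ‖inner ℂ ψ (cfc (fun t : ℝ => f t) T ψ)‖ := Complex.re_le_norm _
    _ ≤ ‖ψ‖ * ‖cfc (fun t : ℝ => f t) T ψ‖ := norm_inner_le_norm _ _
    _ ≤ ‖ψ‖ * (1 * ‖ψ‖) := by
        gcongr
        exact (ContinuousLinearMap.le_opNorm _ _).trans (by gcongr)
    _ = ‖ψ‖ ^ 2 := by ring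

instance isFiniteMeasure_spectralMeasure (T : H →L[ℂ] H) (ψ : H) :
    IsFiniteMeasure (spectralMeasure T ψ) := by
  have : (spectralMeasure T ψ).Regular := by
    unfold spectralMeasure; infer_instance
  refine ⟨lt_of_le_of_lt ?_ (ENNReal.ofReal_lt_top (r := ‖ψ‖ ^ 2))⟩
  rw [isOpen_univ.measure_eq_iSup_isCompact]
  refine iSup₂_le fun K _ => iSup_le fun hK => ?_
  obtain ⟨f, hfK, -, hfc, hf⟩ := exists_continuous_one_zero_of_isCompact hK isClosed_empty
    (Set.disjoint_empty K)
  let g : C_c(ℝ, ℝ) := ⟨f, hfc⟩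
  refine (RealRMK.rieszMeasure_le_of_eq_one (spectralFunctional T ψ) (f := g)
    (fun t => (hf t).1) hK (fun t ht => hfK ht)).trans ?_
  exact ENNReal.ofReal_le_ofReal
    (spectralFunctional_le T ψ g (fun t => (hf t).2) (fun t => (hf t).1))

/-- The mixed spectral measure `B ↦ ⟨φ, χ_B(T) ψ⟩` of a bounded self-adjoint operator `T`, a complex
Borel measure on `ℝ`, obtained from the spectral measures by polarization:
`4⟨φ, Aψ⟩ = ⟨φ+ψ, A(φ+ψ)⟩ - ⟨φ-ψ, A(φ-ψ)⟩ + i (⟨φ-iψ, A(φ-iψ)⟩ - ⟨φ+iψ, A(φ+iψ)⟩)`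
(the inner product is conjugate-linear in its first argument). -/
def mixedSpectralMeasure (T : H →L[ℂ] H) (φ ψ : H) : ComplexMeasure ℝ :=
  SignedMeasure.toComplexMeasure
    ((1 / 4 : ℝ) • ((spectralMeasure T (φ + ψ)).toSignedMeasure
      - (spectralMeasure T (φ - ψ)).toSignedMeasure))
    ((1 / 4 : ℝ) • ((spectralMeasure T (φ - Complex.I • ψ)).toSignedMeasure
      - (spectralMeasure T (φ + Complex.I • ψ)).toSignedMeasure))

/-- The defining property of the mixed spectral measure `μ`: for all `f ∈ C_c(ℝ)` one has
`∫ f d(Re μ) + i ∫ f d(Im μ) = ⟨φ, f(T) ψ⟩`. -/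
theorem mixedSpectralMeasure_spec (T : H →L[ℂ] H) (φ ψ : H) (f : C_c(ℝ, ℝ)) :
    (((1 / 4 : ℝ) * ((∫ t, f t ∂spectralMeasure T (φ + ψ))
        - ∫ t, f t ∂spectralMeasure T (φ - ψ)) : ℝ) : ℂ)
      + (((1 / 4 : ℝ) * ((∫ t, f t ∂spectralMeasure T (φ - Complex.I • ψ))
        - ∫ t, f t ∂spectralMeasure T (φ + Complex.I • ψ)) : ℝ) : ℂ) * Complex.I
      = inner ℂ φ (cfc (fun t : ℝ => f t) T ψ) := by
  simp only [integral_spectralMeasure]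
  have hs : IsSelfAdjoint (cfc (fun t : ℝ => f t) T) := cfc_predicate _ _
  set A := cfc (fun t : ℝ => f t) T
  have hsym := hs.isSymmetric
  have h1 : inner ℂ ψ (A φ) = starRingEnd ℂ (inner ℂ φ (A ψ)) := by
    rw [inner_conj_symm]; exact (hsym ψ φ).symm
  simp only [map_add, map_sub, map_smul, inner_add_left, inner_add_right, inner_sub_left,
    inner_sub_right, inner_smul_left, inner_smul_right, h1]
  apply Complex.ext
  · simp [-inner_conj_symm]
    ring
  · simp [-inner_conj_symm]
    ring

end Spectral

/-! ### The Anderson Hamiltonian -/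

/-- The Hilbert space `ℓ²(ℤ^d)`. -/
abbrev LatticeL2 (d : ℕ) : Type := lp (fun _ : Fin d → ℤ => ℂ) 2

/-- The canonical basis vector `e_x` of `ℓ²(ℤ^d)`. -/
def basisVec {d : ℕ} (x : Fin d → ℤ) : LatticeL2 d := lp.single 2 x (1 : ℂ)

/-- The translation operator `(τ_k u)(n) = u(n + k)` on `ℓ²(ℤ^d)`. -/
def translationOp {d : ℕ} (k : Fin d → ℤ) : LatticeL2 d →L[ℂ] LatticeL2 d :=
  LinearMap.mkContinuous
    { toFun := fun u => ⟨fun n => u (n + k), by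
        have h := (memℓp_gen_iff (p := 2) (by norm_num)).1 (lp.memℓp u)
        exact (memℓp_gen_iff (p := 2) (by norm_num)).2
          ((Equiv.addRight k).summable_iff.2 h)⟩
      map_add' := fun _ _ => rfl
      map_smul' := fun _ _ => rfl }
    1 (by
      intro u
      rw [one_mul, lp.norm_eq_tsum_rpow (by norm_num), lp.norm_eq_tsum_rpow (by norm_num)]
      exact le_of_eq (congrArg (· ^ (1 / (2 : ℝ≥0∞).toReal))
        ((Equiv.addRight k).tsum_eq fun n => ‖u n‖ ^ (2 : ℝ≥0∞).toReal)))

/-- The operator of multiplication by a bounded function `V` on `ℓ²(ℤ^d)`. -/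
def boundedMulOp {d : ℕ} (V : (Fin d → ℤ) → ℝ) (M : ℝ) (hM : ∀ n, |V n| ≤ M) :
    LatticeL2 d →L[ℂ] LatticeL2 d :=
  LinearMap.mkContinuous
    { toFun := fun u => ⟨fun n => (V n : ℂ) * u n, by
        refine Memℓp.mono' (g := fun n => (M : ℂ) * u n) ((lp.memℓp u).const_mul (M : ℂ)) ?_
        intro n
        rw [norm_mul, norm_mul, Complex.norm_real, Complex.norm_real, Real.norm_eq_abs,
          Real.norm_eq_abs]
        exact mul_le_mul_of_nonneg_right ((hM n).trans (le_abs_self M)) (norm_nonneg _)⟩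
      map_add' := fun u v => by
        ext n; exact mul_add _ _ _
      map_smul' := fun c u => by
        ext n; exact mul_left_comm _ _ _ }
    |M| (by
      intro u
      have h : ‖(M : ℂ) • u‖ = |M| * ‖u‖ := by
        rw [norm_smul, Complex.norm_real, Real.norm_eq_abs]
      rw [← h]
      refine lp.norm_mono (by norm_num) fun n => ?_
      change ‖(V n : ℂ) * u n‖ ≤ ‖(M : ℂ) * u n‖
      rw [norm_mul, norm_mul, Complex.norm_real, Complex.norm_real, Real.norm_eq_abs,
        Real.norm_eq_abs]
      exact mul_le_mul_of_nonneg_right ((hM n).trans (le_abs_self M)) (norm_nonneg _))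

/-- The discrete Laplacian `(h₀ u)(n) = - ∑_{|k|=1} u(n + k)` on `ℓ²(ℤ^d)`; the `k ∈ ℤ^d` with
`|k| = |k_1| + ... + |k_d| = 1` are the vectors `± e_j`. -/
def discreteLaplacian (d : ℕ) : LatticeL2 d →L[ℂ] LatticeL2 d :=
  -∑ j : Fin d, (translationOp (Pi.single j 1) + translationOp (-Pi.single j 1))

open Classical in
/-- The Schrödinger operator `h = h₀ + V` on `ℓ²(ℤ^d)` for a bounded potential `V : ℤ^d → ℝ`.
(For an unbounded `V` the potential term is dropped; for i.i.d. potentials with compactly supported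
distribution this concerns a null set only.) -/
def andersonOp {d : ℕ} (V : (Fin d → ℤ) → ℝ) : LatticeL2 d →L[ℂ] LatticeL2 d :=
  if h : ∃ M : ℝ, ∀ n, |V n| ≤ M then
    discreteLaplacian d + boundedMulOp V h.choose h.choose_spec
  else discreteLaplacian d

theorem andersonOp_apply {d : ℕ} (V : (Fin d → ℤ) → ℝ) (M : ℝ) (hM : ∀ n, |V n| ≤ M)
    (u : LatticeL2 d) (n : Fin d → ℤ) :
    andersonOp V u n
      = -∑ j : Fin d, (u (n + Pi.single j 1) + u (n - Pi.single j 1)) + V n * u n := by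
  have h : ∃ M : ℝ, ∀ n, |V n| ≤ M := ⟨M, hM⟩
  rw [andersonOp, dif_pos h]
  change (discreteLaplacian d u) n + V n * u n = _
  congr 1
  simp only [discreteLaplacian, neg_apply, sum_apply, lp.coeFn_neg, lp.coeFn_sum, Pi.neg_apply,
    Finset.sum_apply]
  rfl

theorem isSelfAdjoint_andersonOp {d : ℕ} (V : (Fin d → ℤ) → ℝ) : IsSelfAdjoint (andersonOp V) := by
  rw [ContinuousLinearMap.isSelfAdjoint_iff_isSymmetric]
  have hmul : ∀ M hM (u v : LatticeL2 d),
      inner ℂ (boundedMulOp V M hM u) v = inner ℂ u (boundedMulOp V M hM v) := by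
    intro M hM u v
    rw [lp.inner_eq_tsum, lp.inner_eq_tsum]
    refine tsum_congr fun n => ?_
    change inner ℂ ((V n : ℂ) * u n) (v n) = inner ℂ (u n) ((V n : ℂ) * v n)
    simp [mul_left_comm, mul_assoc]
  have htr : ∀ (k : Fin d → ℤ) (u v : LatticeL2 d),
      inner ℂ (translationOp k u) v = inner ℂ u (translationOp (-k) v) := by
    intro k u v
    rw [lp.inner_eq_tsum, lp.inner_eq_tsum,
      ← (Equiv.addRight k).tsum_eq (fun n => inner ℂ (u n) ((translationOp (-k) v) n))]
    refine tsum_congr fun n => ?_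
    change inner ℂ (u (n + k)) (v n) = inner ℂ (u (n + k)) (v (n + k + -k))
    simp
  have hlap : ∀ u v, inner ℂ (discreteLaplacian d u) v = inner ℂ u (discreteLaplacian d v) := by
    intro u v
    simp only [discreteLaplacian, neg_apply, sum_apply, inner_neg_left, inner_neg_right, sum_inner,
      inner_sum, add_apply, inner_add_left, inner_add_right, htr, neg_neg]
    congr 1
    exact Finset.sum_congr rfl fun _ _ => add_comm _ _
  intro u v
  change inner ℂ (andersonOp V u) v = inner ℂ u (andersonOp V v)
  unfold andersonOp
  split_ifs with h
  · simp only [add_apply, inner_add_left, inner_add_right, hlap, hmul]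
  · exact hlap u v

/-! ### Finite volume restrictions -/

/-- The box `Λ_L = [-L, L]^d ∩ ℤ^d`. -/
def latticeBox (d L : ℕ) : Finset (Fin d → ℤ) :=
  Finset.Icc (fun _ => -(L : ℤ)) (fun _ => (L : ℤ))

/-- The matrix of the restriction of `h₀ + V` to `ℓ²(Λ_L)` in the canonical basis. -/
def boxHamiltonian {d : ℕ} (V : (Fin d → ℤ) → ℝ) (L : ℕ) :
    Matrix (latticeBox d L) (latticeBox d L) ℂ :=
  Matrix.of fun n m =>
    (if ∑ i, |n.1 i - m.1 i| = 1 then -1 else 0) + (if n = m then (V n.1 : ℂ) else 0)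

open Classical in
/-- The Green function `G^{Λ_L}(x, y; E) = ⟨e_x, (h^{Λ_L} - E)⁻¹ e_y⟩` at real energy `E`, for
`x, y ∈ Λ_L`. (It is set to `0` if `x ∉ Λ_L` or `y ∉ Λ_L`, which for given `x, y` concerns finitely
many `L`, and at the finitely many `E` that are eigenvalues of `h^{Λ_L}`.) -/
def boxGreen {d : ℕ} (V : (Fin d → ℤ) → ℝ) (L : ℕ) (x y : Fin d → ℤ) (E : ℝ) : ℂ :=
  if h : x ∈ latticeBox d L ∧ y ∈ latticeBox d L then
    (boxHamiltonian V L - (E : ℂ) • (1 : Matrix (latticeBox d L) (latticeBox d L) ℂ))⁻¹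
      ⟨x, h.1⟩ ⟨y, h.2⟩
  else 0

/-! ### The random potential -/

/-- `ρ` is a probability density on `ℝ` in `L^∞_0(ℝ)`, i.e. (essentially) bounded and vanishing
almost everywhere outside a compact set. -/
structure IsBoundedCompactDensity (ρ : ℝ → ℝ) : Prop where
  memLp_top : MemLp ρ ∞ volume
  nonneg : ∀ᵐ v, 0 ≤ ρ v
  compact_support : ∃ K : Set ℝ, IsCompact K ∧ ∀ᵐ v, v ∉ K → ρ v = 0
  integral_eq_one : ∫ v, ρ v = 1

/-- `(ω_n)_{n ∈ ℤ^d}` are independent real random variables on the probability space `(Ω, P)`, each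
of which has distribution `ρ(v) dv`. -/
structure IsIIDPotential {d : ℕ} {Ω : Type*} [MeasurableSpace Ω] (P : Measure Ω)
    (ω : (Fin d → ℤ) → Ω → ℝ) (ρ : ℝ → ℝ) : Prop where
  measurable : ∀ n, Measurable (ω n)
  indep : iIndepFun ω P
  law : ∀ n, P.map (ω n) = volume.withDensity fun v => ENNReal.ofReal (ρ v)

end

/-! In a box, the correlator Q = ∑ |ψ_k(x)||ψ_k(y)| over eigenvalues E_k ∈ I dominates the mass on I
of the mixed spectral measure. Hölder and ∑_k |ψ_k(y)|² = 1 give Q^(2-s) ≤ ∑ |ψ_k(x)|^(2-s)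
|ψ_k(y)|^s. Freeze every site except x and let v be the potential there. The eigenvalue equations at
the other sites determine the ratio r(E) = |ψ(y)/ψ(x)|, so r does not depend on v, and the sum
becomes ∫_I r^s dμ_v, with μ_v the spectral measure at e_x (`eigenCorr_rpow_le`). Spectral averaging
bounds ∫ μ_v dv by Lebesgue measure (`lintegral_lintegral_specMeasure_le`), and a density bounded by
N costs a factor N.

Conversely, for every v, r(E) = |G(y,x;E)| / |G(x,x;E)| and 1/G(x,x;E) = v - v_E, where v_E is the
coupling that makes E an eigenvalue. If the disorder lives in [-M, M], only energies with |v_E| ≤ M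
count, so r ≤ 2M |G| (`eigenRatio_le`). Averaging over v once more, then over the other sites, with
Jensen and Tonelli, gives the box estimate `lintegral_le_green` with constant (N (2M)^s)^(1/(2-s)).

For infinite volume, the variation on an open interval is a supremum of sums ∑ |⟨e_x, f_i(h) e_y⟩|
over one countable collection of families of disjointly supported functions
(`exists_countable_variation_eq_iSup`). Each matrix element is a limit of box matrix elements
(`tendsto_boxFun`). This yields measurability, and Fatou's lemma produces the liminf. -/

noncomputable section

/-! ### Functional calculus of Hermitian matrices. -/

namespace HermitianMatrix

variable {ι : Type*} [Fintype ι] [DecidableEq ι] {A : Matrix ι ι ℂ}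

/-- The matrix `f(A)` for a Hermitian matrix `A` and an arbitrary function `f : ℝ → ℂ`. -/
def funCalc (hA : A.IsHermitian) (f : ℝ → ℂ) : Matrix ι ι ℂ :=
  (hA.eigenvectorUnitary : Matrix ι ι ℂ) * Matrix.diagonal (fun k => f (hA.eigenvalues k)) *
    star (hA.eigenvectorUnitary : Matrix ι ι ℂ)

theorem funCalc_apply (hA : A.IsHermitian) (f : ℝ → ℂ) (x y : ι) :
    funCalc hA f x y = ∑ k, f (hA.eigenvalues k) *
      (hA.eigenvectorBasis k x * star (hA.eigenvectorBasis k y)) := by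
  rw [funCalc, Matrix.mul_apply]
  simp only [Matrix.mul_diagonal, Matrix.star_apply, Matrix.IsHermitian.eigenvectorUnitary_apply]
  exact Finset.sum_congr rfl fun k _ => by ring

theorem funCalc_mul (hA : A.IsHermitian) (f g : ℝ → ℂ) :
    funCalc hA f * funCalc hA g = funCalc hA (fun t => f t * g t) := by
  have h : star (hA.eigenvectorUnitary : Matrix ι ι ℂ) * (hA.eigenvectorUnitary : Matrix ι ι ℂ)
      = 1 := Unitary.coe_star_mul_self _
  simp only [funCalc]
  rw [← Matrix.diagonal_mul_diagonal]
  simp only [Matrix.mul_assoc]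
  rw [← Matrix.mul_assoc (star _) (hA.eigenvectorUnitary : Matrix ι ι ℂ), h, Matrix.one_mul]

theorem funCalc_one (hA : A.IsHermitian) : funCalc hA (fun _ => 1) = 1 := by
  simp only [funCalc, Matrix.diagonal_one, Matrix.mul_one]
  exact Unitary.coe_mul_star_self _

theorem funCalc_id (hA : A.IsHermitian) : funCalc hA (fun t => (t : ℂ)) = A :=
  hA.spectral_theorem.symm

theorem funCalc_const_mul (hA : A.IsHermitian) (c : ℂ) (f : ℝ → ℂ) :
    funCalc hA (fun t => c * f t) = c • funCalc hA f := by
  ext x y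
  simp [funCalc_apply, Finset.mul_sum, mul_assoc]

theorem funCalc_add (hA : A.IsHermitian) (f g : ℝ → ℂ) :
    funCalc hA (fun t => f t + g t) = funCalc hA f + funCalc hA g := by
  ext x y
  simp [funCalc_apply, add_mul, Finset.sum_add_distrib]

theorem funCalc_pow (hA : A.IsHermitian) (n : ℕ) :
    funCalc hA (fun t => (t : ℂ) ^ n) = A ^ n := by
  induction n with
  | zero => simpa using funCalc_one hA
  | succ n ih =>
    have h := funCalc_mul hA (fun t => (t : ℂ) ^ n) (fun t => (t : ℂ))
    rw [ih, funCalc_id] at h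
    simp only [pow_succ, h]

/-- Polynomials in A are free of any choice of eigenvectors; measurability in A and the
infinite-volume limit both pass through them. -/
theorem funCalc_polynomial (hA : A.IsHermitian) (p : Polynomial ℝ) :
    funCalc hA (fun t => ((p.eval t : ℝ) : ℂ)) = Polynomial.aeval A p := by
  induction p using Polynomial.induction_on' with
  | add p q hp hq => simp [funCalc_add, hp, hq]
  | monomial n a =>
    have := funCalc_const_mul hA (a : ℂ) (fun t => (t : ℂ) ^ n)
    simp only [Polynomial.eval_monomial, Complex.ofReal_mul, Complex.ofReal_pow, this,
      funCalc_pow, Polynomial.aeval_monomial]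
    ext x y
    simp [Algebra.algebraMap_eq_smul_one]

theorem sum_norm_sq_eigenvectorBasis (hA : A.IsHermitian) (x : ι) :
    ∑ k, ‖hA.eigenvectorBasis k x‖ ^ 2 = 1 := by
  have h := congrFun (congrFun (funCalc_one hA) x) x
  rw [funCalc_apply, Matrix.one_apply_eq] at h
  have : ((∑ k, ‖hA.eigenvectorBasis k x‖ ^ 2 : ℝ) : ℂ) = 1 := by
    rw [← h]; push_cast
    exact Finset.sum_congr rfl fun k _ => by
      rw [one_mul]; exact (RCLike.mul_conj _).symm
  exact_mod_cast this

theorem sum_norm_mul_norm_le_one (hA : A.IsHermitian) (x y : ι) :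
    ∑ k, ‖hA.eigenvectorBasis k x‖ * ‖hA.eigenvectorBasis k y‖ ≤ 1 := by
  have h := Finset.sum_le_sum fun k (_ : k ∈ Finset.univ) =>
    two_mul_le_add_sq ‖hA.eigenvectorBasis k x‖ ‖hA.eigenvectorBasis k y‖
  rw [Finset.sum_add_distrib, sum_norm_sq_eigenvectorBasis, sum_norm_sq_eigenvectorBasis] at h
  simp only [mul_assoc, ← Finset.mul_sum] at h
  linarith

theorem norm_funCalc_sub_le (hA : A.IsHermitian) (f g : ℝ → ℂ) (ε : ℝ)
    (h : ∀ k, ‖f (hA.eigenvalues k) - g (hA.eigenvalues k)‖ ≤ ε) (x y : ι) :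
    ‖funCalc hA f x y - funCalc hA g x y‖ ≤ ε := by
  have hε : 0 ≤ ε := by
    -- Here `x` serves as an eigenvalue index, only to witness that there is one.
    exact (norm_nonneg _).trans (h x)
  rw [funCalc_apply, funCalc_apply, ← Finset.sum_sub_distrib]
  calc ‖∑ k, (f (hA.eigenvalues k) * _ - g (hA.eigenvalues k) * _)‖
      ≤ ∑ k, ε * (‖hA.eigenvectorBasis k x‖ * ‖hA.eigenvectorBasis k y‖) := by
        refine norm_sum_le_of_le _ fun k _ => ?_
        rw [← sub_mul, norm_mul, norm_mul, norm_star]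
        exact mul_le_mul_of_nonneg_right (h k) (by positivity)
    _ ≤ ε := by
        rw [← Finset.mul_sum]
        exact mul_le_of_le_one_right hε (sum_norm_mul_norm_le_one hA x y)

theorem funCalc_resolvent (hA : A.IsHermitian) (z : ℂ) (hz : z.im ≠ 0) :
    (A - z • (1 : Matrix ι ι ℂ))⁻¹ = funCalc hA (fun t => ((t : ℂ) - z)⁻¹) := by
  refine Matrix.inv_eq_left_inv ?_
  have h : A - z • (1 : Matrix ι ι ℂ) = funCalc hA (fun t => (t : ℂ) + (-z) * 1) := by
    rw [funCalc_add, funCalc_const_mul hA (-z) (fun _ => 1), funCalc_one, funCalc_id]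
    simp [sub_eq_add_neg]
  rw [h, funCalc_mul, ← funCalc_one hA]
  congr 1
  ext t
  have : (t : ℂ) - z ≠ 0 := by
    intro h0
    apply hz
    have := congrArg Complex.im h0
    simpa using this
  rw [mul_one, ← sub_eq_add_neg, inv_mul_cancel₀ this]

/-- A sequence of real polynomials approximating `f` uniformly on compact sets. -/
theorem exists_polynomial_seq (f : ℝ → ℝ) (hf : Continuous f) :
    ∃ p : ℕ → Polynomial ℝ, ∀ n : ℕ, ∀ t : ℝ, |t| ≤ n →
      |(p n).eval t - f t| ≤ 1 / ((n : ℝ) + 1) := by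
  have h : ∀ n : ℕ, ∃ p : Polynomial ℝ, ∀ t ∈ Set.Icc (-(n : ℝ)) n,
      |p.eval t - f t| < 1 / ((n : ℝ) + 1) :=
    fun n => exists_polynomial_near_of_continuousOn _ _ f hf.continuousOn _ (by positivity)
  choose p hp using h
  exact ⟨p, fun n t ht => (hp n t (abs_le.1 ht)).le⟩

theorem tendsto_funCalc_polynomial (hA : A.IsHermitian) {f : ℝ → ℝ} {p : ℕ → Polynomial ℝ}
    (hp : ∀ n : ℕ, ∀ t : ℝ, |t| ≤ n → |(p n).eval t - f t| ≤ 1 / ((n : ℝ) + 1)) (x y : ι) :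
    Tendsto (fun n => (Polynomial.aeval A (p n)) x y) atTop
      (𝓝 (funCalc hA (fun t => (f t : ℂ)) x y)) := by
  rw [tendsto_iff_norm_sub_tendsto_zero]
  refine squeeze_zero' (Eventually.of_forall fun _ => norm_nonneg _) ?_
    tendsto_one_div_add_atTop_nhds_zero_nat
  obtain ⟨N, hN⟩ := exists_nat_ge (∑ k, |hA.eigenvalues k|)
  filter_upwards [eventually_ge_atTop N] with n hn
  rw [← funCalc_polynomial hA]
  refine norm_funCalc_sub_le hA _ _ _ (fun k => ?_) x y
  rw [← Complex.ofReal_sub, Complex.norm_real]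
  refine hp n _ ?_
  calc |hA.eigenvalues k| ≤ ∑ k, |hA.eigenvalues k| :=
        Finset.single_le_sum (f := fun k => |hA.eigenvalues k|) (fun _ _ => abs_nonneg _)
          (Finset.mem_univ k)
    _ ≤ N := hN
    _ ≤ n := by exact_mod_cast hn

/-! ### Measurable dependence on the matrix. -/

section Measurability

variable {α : Type*} [MeasurableSpace α]

omit [DecidableEq ι] in
theorem measurable_matrix_mul {A B : α → Matrix ι ι ℂ} (hA : ∀ x y, Measurable fun a => A a x y)
    (hB : ∀ x y, Measurable fun a => B a x y) (x y : ι) :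
    Measurable fun a => (A a * B a) x y := by
  simp only [Matrix.mul_apply]
  exact Finset.measurable_sum _ fun k _ => (hA x k).mul (hB k y)

theorem measurable_matrix_pow {A : α → Matrix ι ι ℂ} (hA : ∀ x y, Measurable fun a => A a x y)
    (n : ℕ) : ∀ x y, Measurable fun a => (A a ^ n) x y := by
  induction n with
  | zero => intro x y; simp only [pow_zero]; exact measurable_const
  | succ n ih =>
    intro x y
    simp only [pow_succ]
    exact measurable_matrix_mul ih hA x y

theorem measurable_aeval {A : α → Matrix ι ι ℂ} (hA : ∀ x y, Measurable fun a => A a x y)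
    (p : Polynomial ℝ) (x y : ι) : Measurable fun a => (Polynomial.aeval (A a) p) x y := by
  simp only [Polynomial.aeval_eq_sum_range, Matrix.sum_apply, Matrix.smul_apply]
  exact Finset.measurable_sum _ fun k _ => (measurable_matrix_pow hA k x y).const_smul (p.coeff k)

/-- The chosen eigenvectors need not depend measurably on `a`, but f(A) is a pointwise limit of
polynomials in A. -/
theorem measurable_funCalc {A : α → Matrix ι ι ℂ} (hA : ∀ x y, Measurable fun a => A a x y)
    (hH : ∀ a, (A a).IsHermitian) {f : ℝ → ℝ} (hf : Continuous f) (x y : ι) :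
    Measurable fun a => funCalc (hH a) (fun t => (f t : ℂ)) x y := by
  obtain ⟨p, hp⟩ := exists_polynomial_seq f hf
  exact measurable_of_tendsto_metrizable (fun n => measurable_aeval hA (p n) x y)
    (tendsto_pi_nhds.2 fun a => tendsto_funCalc_polynomial (hH a) hp x y)

theorem measurable_det {κ : Type*} [Fintype κ] [DecidableEq κ] {A : α → Matrix κ κ ℂ}
    (hA : ∀ x y, Measurable fun a => A a x y) :
    Measurable fun a => (A a).det := by
  simp only [Matrix.det_apply]
  exact Finset.measurable_sum _ fun σ _ =>
    (Finset.measurable_prod _ fun k _ => hA _ _).const_smul _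

theorem measurable_inv {A : α → Matrix ι ι ℂ} (hA : ∀ x y, Measurable fun a => A a x y) (x y : ι) :
    Measurable fun a => (A a)⁻¹ x y := by
  simp only [Matrix.inv_def, Matrix.smul_apply, Matrix.adjugate_apply, smul_eq_mul,
    Ring.inverse_eq_inv']
  refine (measurable_det hA).inv.mul (measurable_det fun i j => ?_)
  by_cases h : i = y
  · subst h; simp only [Matrix.updateRow_self]; exact measurable_const
  · simp only [Matrix.updateRow_ne h]; exact hA i j

end Measurability

/-! ### Spectral measures of Hermitian matrices. -/

/-- The spectral measure of a Hermitian matrix at the basis vector `x`. -/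
def specMeasure (hA : A.IsHermitian) (x : ι) : Measure ℝ :=
  ∑ k, ‖hA.eigenvectorBasis k x‖ₑ ^ 2 • Measure.dirac (hA.eigenvalues k)

theorem lintegral_specMeasure (hA : A.IsHermitian) (x : ι) (f : ℝ → ℝ≥0∞) :
    ∫⁻ t, f t ∂specMeasure hA x
      = ∑ k, ‖hA.eigenvectorBasis k x‖ₑ ^ 2 * f (hA.eigenvalues k) := by
  simp [specMeasure, lintegral_finsetSum_measure]

theorem sum_enorm_sq_eigenvectorBasis (hA : A.IsHermitian) (x : ι) :
    ∑ k, ‖hA.eigenvectorBasis k x‖ₑ ^ 2 = 1 := by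
  have h := congrArg ENNReal.ofReal (sum_norm_sq_eigenvectorBasis hA x)
  rw [ENNReal.ofReal_sum_of_nonneg fun _ _ => by positivity] at h
  simpa [ENNReal.ofReal_pow] using h

instance isProbabilityMeasure_specMeasure (hA : A.IsHermitian) (x : ι) :
    IsProbabilityMeasure (specMeasure hA x) :=
  ⟨by rw [← lintegral_one, lintegral_specMeasure]; simp [sum_enorm_sq_eigenvectorBasis]⟩

theorem lintegral_specMeasure_ofReal (hA : A.IsHermitian) (x : ι) (f : ℝ → ℝ)
    (hf : ∀ t, 0 ≤ f t) :
    ∫⁻ t, ENNReal.ofReal (f t) ∂specMeasure hA x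
      = ENNReal.ofReal (funCalc hA (fun t => (f t : ℂ)) x x).re := by
  have : (funCalc hA (fun t => (f t : ℂ)) x x).re
      = ∑ k, ‖hA.eigenvectorBasis k x‖ ^ 2 * f (hA.eigenvalues k) := by
    rw [funCalc_apply, Complex.re_sum]
    refine Finset.sum_congr rfl fun k _ => ?_
    have h : hA.eigenvectorBasis k x * star (hA.eigenvectorBasis k x)
        = ((‖hA.eigenvectorBasis k x‖ ^ 2 : ℝ) : ℂ) := by
      push_cast; exact RCLike.mul_conj _
    rw [h, ← Complex.ofReal_mul, Complex.ofReal_re, mul_comm]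
  rw [this, lintegral_specMeasure,
    ENNReal.ofReal_sum_of_nonneg fun k _ => mul_nonneg (by positivity) (hf _)]
  refine Finset.sum_congr rfl fun k _ => ?_
  rw [ENNReal.ofReal_mul (by positivity), ENNReal.ofReal_pow (norm_nonneg _), ofReal_norm]

/-- Closed sets form a generating π-system, and their masses are limits of integrals of continuous
functions, which `measurable_funCalc` handles. -/
theorem measurable_specMeasure {α : Type*} [MeasurableSpace α] {A : α → Matrix ι ι ℂ}
    (hA : ∀ x y, Measurable fun a => A a x y) (hH : ∀ a, (A a).IsHermitian) (x : ι) :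
    Measurable fun a => specMeasure (hH a) x := by
  refine Measurable.measure_of_isPiSystem_of_isProbabilityMeasure
    ((BorelSpace.measurable_eq (α := ℝ)).trans borel_eq_generateFrom_isClosed)
    isPiSystem_isClosed fun F hF => ?_
  refine measurable_of_tendsto_metrizable (fun n => ?_) (tendsto_pi_nhds.2 fun a =>
    tendsto_lintegral_thickenedIndicator_of_isClosed (specMeasure (hH a) x) hF
      (δs := fun n : ℕ => 1 / ((n : ℝ) + 1)) (fun n => by positivity)
      tendsto_one_div_add_atTop_nhds_zero_nat)
  have : ∀ a, (∫⁻ t, (thickenedIndicator (show (0:ℝ) < 1 / ((n : ℝ) + 1) by positivity) F t : ℝ≥0∞)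
      ∂specMeasure (hH a) x) = ENNReal.ofReal (funCalc (hH a) (fun t =>
        (((thickenedIndicator (show (0:ℝ) < 1 / ((n : ℝ) + 1) by positivity) F t : ℝ≥0) : ℝ) : ℂ))
          x x).re := by
    intro a
    rw [← lintegral_specMeasure_ofReal (hH a) x _ fun t => NNReal.coe_nonneg _]
    simp
  simp only [this]
  refine (Complex.measurable_re.comp (measurable_funCalc hA hH ?_ x x)).ennreal_ofReal
  fun_prop

/-! ### Rank-one perturbations -/

/-- The matrix with row `x` replaced by the basis vector at `x`. -/
def pinRow (A : Matrix ι ι ℂ) (x : ι) : Matrix ι ι ℂ := A.updateRow x (Pi.single x 1)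

omit [Fintype ι] in
theorem pinRow_add_single (A : Matrix ι ι ℂ) (x : ι) (c : ℂ) :
    pinRow (A + Matrix.single x x c) x = pinRow A x := by
  ext i j
  by_cases h : i = x
  · subst h; simp [pinRow]
  · simp [pinRow, h, Matrix.single, Ne.symm h]

theorem det_add_single (A : Matrix ι ι ℂ) (x : ι) (c : ℂ) :
    (A + Matrix.single x x c).det = A.det + c * (pinRow A x).det := by
  have h : A + Matrix.single x x c = A.updateRow x (A x + c • Pi.single x 1) := by
    ext i j
    by_cases h : i = x
    · subst h; simp [Matrix.single, Pi.single_apply, eq_comm]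
    · simp [h, Matrix.single, Ne.symm h]
  rw [h, Matrix.det_updateRow_add, Matrix.det_updateRow_smul, Matrix.updateRow_eq_self, pinRow]

/-- Cramer's rule. For singular A both sides are 0 by convention. -/
theorem inv_apply_self (A : Matrix ι ι ℂ) (x : ι) :
    A⁻¹ x x = (pinRow A x).det / A.det := by
  rw [Matrix.inv_def, Matrix.smul_apply, Matrix.adjugate_apply, Ring.inverse_eq_inv', smul_eq_mul,
    pinRow, div_eq_inv_mul]

omit [Fintype ι] in
theorem isHermitian_add_single {K : Matrix ι ι ℂ} (hK : K.IsHermitian) (x : ι) (v : ℝ) :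
    (K + Matrix.single x x (v : ℂ)).IsHermitian := by
  refine hK.add ?_
  rw [Matrix.IsHermitian, Matrix.conjTranspose_single]
  simp

/-! ### Spectral averaging. -/

/-- The determinant is affine in v, so the diagonal Green function is 1/(v - w) or identically 0. In
the first case its imaginary part over π is nonpositive or a Cauchy density in v, of total mass 1.
-/
theorem lintegral_inv_im_le (A : Matrix ι ι ℂ) (x : ι) :
    ∫⁻ v : ℝ, ENNReal.ofReal (Real.pi⁻¹ * ((A + Matrix.single x x (v : ℂ))⁻¹ x x).im) ≤ 1 := by
  by_cases hB : (pinRow A x).det = 0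
  · simp [inv_apply_self, pinRow_add_single, hB]
  set w : ℂ := -(A.det / (pinRow A x).det) with hw
  have h : ∀ v : ℝ, (A + Matrix.single x x (v : ℂ))⁻¹ x x = ((v : ℂ) - w)⁻¹ := by
    intro v
    rw [inv_apply_self, pinRow_add_single, det_add_single, hw]
    field_simp
    ring
  have him : ∀ v : ℝ, (((v : ℂ) - w)⁻¹).im = w.im * ((v - w.re) ^ 2 + w.im ^ 2)⁻¹ := by
    intro v
    rw [Complex.inv_im, Complex.normSq_apply]
    simp [div_eq_mul_inv, sq]
  simp only [h, him]
  rcases le_or_gt w.im 0 with hle | hpos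
  · refine le_of_eq_of_le (lintegral_eq_zero_of_ae_eq_zero (Eventually.of_forall fun v => ?_))
      zero_le_one
    refine ENNReal.ofReal_of_nonpos ?_
    have : 0 ≤ Real.pi⁻¹ * ((v - w.re) ^ 2 + w.im ^ 2)⁻¹ := by positivity
    nlinarith
  · obtain ⟨γ, hγ⟩ : ∃ γ : ℝ≥0, (γ : ℝ) = w.im := ⟨w.im.toNNReal, Real.coe_toNNReal _ hpos.le⟩
    have hne : γ ≠ 0 := by
      rintro rfl; exact hpos.ne' (by simpa using hγ.symm)
    rw [← lintegral_cauchyPDF_eq_one w.re hne]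
    refine le_of_eq (lintegral_congr fun v => ?_)
    rw [cauchyPDF_def, cauchyPDFReal_def, hγ, mul_assoc]

/-- The Poisson kernel: Im (t - E - iε)⁻¹ / π is the Cauchy density of width ε centred at t, taken
at E. -/
theorem lintegral_cauchyPDF_specMeasure (hA : A.IsHermitian) (x : ι) {ε : ℝ≥0} (hε : ε ≠ 0)
    (E : ℝ) :
    ∫⁻ t, cauchyPDF t ε E ∂specMeasure hA x
      = ENNReal.ofReal (Real.pi⁻¹ *
        ((A - ((E : ℂ) + (ε : ℝ) * Complex.I) • (1 : Matrix ι ι ℂ))⁻¹ x x).im) := by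
  have hε' : (ε : ℝ) ≠ 0 := by exact_mod_cast hε
  have key : ∀ k, Real.pi⁻¹ * (((hA.eigenvalues k : ℂ) - ((E : ℂ) + (ε : ℝ) * Complex.I))⁻¹ *
      (hA.eigenvectorBasis k x * star (hA.eigenvectorBasis k x))).im
      = ‖hA.eigenvectorBasis k x‖ ^ 2 * cauchyPDFReal (hA.eigenvalues k) ε E := by
    intro k
    have h : hA.eigenvectorBasis k x * star (hA.eigenvectorBasis k x)
        = ((‖hA.eigenvectorBasis k x‖ ^ 2 : ℝ) : ℂ) := by
      push_cast; exact RCLike.mul_conj _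
    rw [h, Complex.im_mul_ofReal, Complex.inv_im, Complex.normSq_apply, cauchyPDFReal_def]
    simp only [Complex.sub_im, Complex.ofReal_im, Complex.add_im, Complex.mul_im, Complex.ofReal_re,
      Complex.I_re, Complex.I_im, Complex.sub_re, Complex.add_re, Complex.mul_re]
    have : (E - hA.eigenvalues k) ^ 2 + (ε : ℝ) ^ 2 ≠ 0 := by positivity
    ring_nf
  rw [funCalc_resolvent hA _ (by simpa using hε'), funCalc_apply, lintegral_specMeasure,
    Complex.im_sum, Finset.mul_sum, ENNReal.ofReal_sum_of_nonneg]
  · refine Finset.sum_congr rfl fun k _ => ?_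
    rw [key, ← ofReal_norm, ← ENNReal.ofReal_pow (norm_nonneg _), cauchyPDF_def,
      ← ENNReal.ofReal_mul (by positivity)]
  · intro k _
    rw [key]
    exact mul_nonneg (by positivity) (cauchyPDF_pos _ hε _).le

theorem setLIntegral_cauchyPDF (t : ℝ) {ε : ℝ≥0} (hε : ε ≠ 0) {U : Set ℝ}
    (hU : MeasurableSet U) :
    ∫⁻ E in U, cauchyPDF t ε E
      = ∫⁻ u, U.indicator 1 (t + ε * u) * cauchyPDF 0 1 u := by
  have hε' : 0 < (ε : ℝ) := by positivity
  have himg : (fun u : ℝ => t + ε * u) '' Set.univ = Set.univ := by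
    refine Set.image_univ_of_surjective fun E => ⟨(E - t) / ε, ?_⟩
    field_simp
    ring
  have h := lintegral_image_eq_lintegral_abs_deriv_mul (s := Set.univ)
    (f := fun u : ℝ => t + ε * u) (f' := fun _ => (ε : ℝ)) MeasurableSet.univ
    (fun u _ => by
      have h := ((hasDerivAt_id u).const_mul (ε : ℝ)).const_add t
      rw [mul_one] at h
      exact h.hasDerivWithinAt)
    (fun a _ b _ hab => by simpa [hε] using hab) (U.indicator fun E => cauchyPDF t ε E)
  rw [himg] at h
  simp only [Measure.restrict_univ] at h
  rw [← lintegral_indicator hU, h]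
  refine lintegral_congr fun u => ?_
  by_cases hu : t + ε * u ∈ U
  · simp only [Set.indicator_of_mem hu, Pi.one_apply, one_mul, cauchyPDF_def, cauchyPDFReal_def]
    rw [← ENNReal.ofReal_mul (abs_nonneg _), abs_of_pos hε']
    congr 1
    have : u ^ 2 + 1 ≠ 0 := by positivity
    simp only [add_sub_cancel_left, sub_zero, NNReal.coe_one]
    field_simp
  · simp [Set.indicator_of_notMem hu]

/-- After rescaling to width 1 the indicator of the open set U tends to 1 pointwise, and Fatou
applies. -/
theorem one_le_liminf_setLIntegral_cauchyPDF {U : Set ℝ} (hU : IsOpen U) {t : ℝ} (ht : t ∈ U)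
    {ε : ℕ → ℝ≥0} (hε : ∀ n, ε n ≠ 0) (hlim : Tendsto ε atTop (𝓝 0)) :
    1 ≤ liminf (fun n => ∫⁻ E in U, cauchyPDF t (ε n) E) atTop := by
  simp only [fun n => setLIntegral_cauchyPDF t (hε n) hU.measurableSet]
  refine le_trans ?_ (lintegral_liminf_le fun n => ?_)
  · rw [← lintegral_cauchyPDF_eq_one 0 one_ne_zero]
    refine lintegral_mono fun u => ?_
    refine le_liminf_of_le (by isBoundedDefault) ?_
    have hc : Tendsto (fun n => t + (ε n : ℝ) * u) atTop (𝓝 (t + ((0 : ℝ≥0) : ℝ) * u)) :=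
      ((NNReal.tendsto_coe.2 hlim).mul_const u).const_add t
    rw [NNReal.coe_zero, zero_mul, add_zero] at hc
    filter_upwards [hc.eventually (hU.mem_nhds ht)] with n hn
    simp [Set.indicator_of_mem hn]
  · refine Measurable.mul ?_ (measurable_cauchyPDF 0 1)
    exact (measurable_one.indicator hU.measurableSet).comp (by fun_prop)

omit [Fintype ι] in
theorem measurable_add_single (K : Matrix ι ι ℂ) (x i j : ι) :
    Measurable fun v : ℝ => (K + Matrix.single x x (v : ℂ)) i j := by
  simp only [Matrix.add_apply, Matrix.single_apply]
  refine measurable_const.add ?_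
  split_ifs
  · exact Complex.measurable_ofReal
  · exact measurable_const

/-- Spectral averaging over a rank-one perturbation, on open sets. -/
theorem lintegral_specMeasure_isOpen_le {K : Matrix ι ι ℂ} (hK : K.IsHermitian) (x : ι) {U : Set ℝ}
    (hU : IsOpen U) :
    ∫⁻ v : ℝ, specMeasure (isHermitian_add_single hK x v) x U ≤ volume U := by
  set ε : ℕ → ℝ≥0 := fun n => 1 / ((n : ℝ≥0) + 1) with hεdef
  have hε : ∀ n, ε n ≠ 0 := fun n => by positivity
  have hlim : Tendsto ε atTop (𝓝 0) := tendsto_one_div_add_atTop_nhds_zero_nat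
  set g : ℕ → ℝ → ℝ → ℝ≥0∞ := fun n v E => ENNReal.ofReal (Real.pi⁻¹ *
        (((K + Matrix.single x x (v : ℂ)) -
          ((E : ℂ) + (ε n : ℝ) * Complex.I) • (1 : Matrix ι ι ℂ))⁻¹ x x).im) with hg
  have hgm : ∀ n, Measurable (Function.uncurry (g n)) := by
    intro n
    refine (measurable_const.mul (Complex.measurable_im.comp
      (measurable_inv (fun i j => ?_) x x))).ennreal_ofReal
    simp only [Matrix.sub_apply, Matrix.smul_apply]
    refine ((measurable_add_single K x i j).comp measurable_fst).sub ?_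
    exact ((Complex.measurable_ofReal.comp measurable_snd).add_const _).smul_const _
  -- Smoothing the spectral measure at scale ε loses no mass on an open set in the limit. Only this
  -- inequality is needed, so Fatou suffices.
  have h1 : ∀ v : ℝ, specMeasure (isHermitian_add_single hK x v) x U
      ≤ liminf (fun n => ∫⁻ E in U, g n v E) atTop := by
    intro v
    have hsw : ∀ n, ∫⁻ E in U, g n v E
        = ∫⁻ t, (∫⁻ E in U, cauchyPDF t (ε n) E)
          ∂specMeasure (isHermitian_add_single hK x v) x := by
      intro n
      rw [lintegral_specMeasure]
      simp only [hg, ← lintegral_cauchyPDF_specMeasure (isHermitian_add_single hK x v) x (hε n),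
        lintegral_specMeasure]
      rw [lintegral_finsetSum]
      · exact Finset.sum_congr rfl fun k _ =>
          lintegral_const_mul _ (measurable_cauchyPDF _ _)
      · exact fun k _ => (measurable_cauchyPDF _ _).const_mul _
    simp only [hsw]
    have hm : ∀ n, Measurable fun t => ∫⁻ E in U, cauchyPDF t (ε n) E := by
      intro n
      have hm2 : Measurable (Function.uncurry fun t E : ℝ => cauchyPDF t (ε n) E) := by
        simp only [cauchyPDF, cauchyPDFReal, Function.uncurry_def]
        fun_prop
      exact hm2.lintegral_prod_right'
    refine le_trans ?_ (lintegral_liminf_le hm)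
    rw [← lintegral_indicator_one hU.measurableSet]
    refine lintegral_mono fun t => ?_
    by_cases ht : t ∈ U
    · rw [Set.indicator_of_mem ht]
      exact one_le_liminf_setLIntegral_cauchyPDF hU ht hε hlim
    · simp [Set.indicator_of_notMem ht]
  calc ∫⁻ v : ℝ, specMeasure (isHermitian_add_single hK x v) x U
      ≤ ∫⁻ v : ℝ, liminf (fun n => ∫⁻ E in U, g n v E) atTop := lintegral_mono h1
    _ ≤ liminf (fun n => ∫⁻ v : ℝ, ∫⁻ E in U, g n v E) atTop :=
        lintegral_liminf_le fun n => (hgm n).lintegral_prod_right'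
    _ ≤ liminf (fun _ : ℕ => volume U) atTop := by
        refine liminf_le_liminf (Eventually.of_forall fun n => ?_)
        rw [lintegral_lintegral_swap (hgm n).aemeasurable]
        calc ∫⁻ E in U, ∫⁻ v : ℝ, g n v E ≤ ∫⁻ E in U, 1 := by
              refine lintegral_mono fun E => ?_
              refine le_of_eq_of_le (lintegral_congr fun v => ?_) (lintegral_inv_im_le
                (K - ((E : ℂ) + (ε n : ℝ) * Complex.I) • (1 : Matrix ι ι ℂ)) x)
              simp only [hg]
              rw [add_sub_right_comm]
          _ = volume U := by simp
    _ = volume U := by simp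

/-- Spectral averaging over a rank-one perturbation. -/
theorem lintegral_lintegral_specMeasure_le {K : Matrix ι ι ℂ} (hK : K.IsHermitian) (x : ι)
    {f : ℝ → ℝ≥0∞} (hf : Measurable f) :
    ∫⁻ v : ℝ, ∫⁻ t, f t ∂specMeasure (isHermitian_add_single hK x v) x ≤ ∫⁻ t, f t := by
  have hκ := measurable_specMeasure (measurable_add_single K x) (isHermitian_add_single hK x) x
  rw [← Measure.lintegral_bind hκ.aemeasurable hf.aemeasurable]
  -- Outer regularity of Lebesgue measure extends the bound from open sets to all Borel sets.
  refine lintegral_mono' (Measure.le_intro fun s hs _ => ?_) le_rfl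
  rw [s.measure_eq_iInf_isOpen volume]
  refine le_iInf₂ fun U hsU => le_iInf fun hU => ?_
  refine (measure_mono hsU).trans ?_
  rw [Measure.bind_apply hU.measurableSet hκ.aemeasurable]
  exact lintegral_specMeasure_isOpen_le hK x hU

/-- The pinned matrix sends u to u(x) e_x. It ignores row x of A, hence the potential at x. -/
theorem apply_eq_of_mulVec_eq_zero {x : ι} {u : ι → ℂ} (hu : ∀ i, i ≠ x → (A.mulVec u) i = 0)
    (hB : (pinRow A x).det ≠ 0) (y : ι) : u y = (pinRow A x)⁻¹ y x * u x := by
  have h : (pinRow A x).mulVec u = Pi.single x (u x) := by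
    ext i
    by_cases hi : i = x
    · subst hi; simp [pinRow, Matrix.mulVec]
    · rw [Pi.single_eq_of_ne hi, ← hu i hi]; simp [pinRow, Matrix.mulVec, hi]
  have h2 := congrArg (fun w => (pinRow A x)⁻¹.mulVec w y) h
  simpa [Matrix.mulVec_mulVec, Matrix.nonsing_inv_mul _ (isUnit_iff_ne_zero.2 hB)] using h2

open Classical in
/-- The modulus of the ratio `ψ(y) / ψ(x)` for solutions of `(K + v |x⟩⟨x|) ψ = E ψ`, which does not
depend on `v`; infinite if it is not determined. -/
def eigenRatio (K : Matrix ι ι ℂ) (x y : ι) (E : ℝ) : ℝ≥0∞ :=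
  if (pinRow (K - (E : ℂ) • 1) x).det = 0 then ⊤ else ‖(pinRow (K - (E : ℂ) • 1) x)⁻¹ y x‖ₑ

omit [Fintype ι] in
theorem measurable_sub_smul_one (K : Matrix ι ι ℂ) (i j : ι) :
    Measurable fun E : ℝ => (K - (E : ℂ) • (1 : Matrix ι ι ℂ)) i j := by
  simp only [Matrix.sub_apply, Matrix.smul_apply]
  exact measurable_const.sub (Complex.measurable_ofReal.smul_const _)

omit [Fintype ι] in
theorem measurable_pinRow_sub_smul_one (K : Matrix ι ι ℂ) (x i j : ι) :
    Measurable fun E : ℝ => pinRow (K - (E : ℂ) • (1 : Matrix ι ι ℂ)) x i j := by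
  by_cases h : i = x
  · subst h; simp only [pinRow, Matrix.updateRow_self]; exact measurable_const
  · simp only [pinRow, Matrix.updateRow_ne h]; exact measurable_sub_smul_one K i j

theorem measurable_eigenRatio (K : Matrix ι ι ℂ) (x y : ι) : Measurable (eigenRatio K x y) := by
  refine Measurable.ite ?_ measurable_const
    (measurable_inv (measurable_pinRow_sub_smul_one K x) y x).enorm
  exact measurable_det (measurable_pinRow_sub_smul_one K x) (measurableSet_singleton 0)

omit [Fintype ι] in
theorem pinRow_add_single_sub (K : Matrix ι ι ℂ) (x : ι) (c z : ℂ) :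
    pinRow (K + Matrix.single x x c - z • 1) x = pinRow (K - z • 1) x := by
  rw [add_sub_right_comm, pinRow_add_single]

theorem det_sub_eigenvalue (hA : A.IsHermitian) (k : ι) :
    (A - (hA.eigenvalues k : ℂ) • (1 : Matrix ι ι ℂ)).det = 0 := by
  rw [← Matrix.exists_mulVec_eq_zero_iff]
  refine ⟨⇑(hA.eigenvectorBasis k), ?_, ?_⟩
  · intro h
    have h0 : hA.eigenvectorBasis k = 0 := PiLp.ext fun i => congrFun h i
    exact hA.eigenvectorBasis.orthonormal.ne_zero k h0
  · rw [Matrix.sub_mulVec, hA.mulVec_eigenvectorBasis, Matrix.smul_mulVec, Matrix.one_mulVec]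
    ext i; simp

theorem enorm_eigenvector_le {K : Matrix ι ι ℂ} (hK : K.IsHermitian) (x y : ι) (v : ℝ) (k : ι)
    (hx : (isHermitian_add_single hK x v).eigenvectorBasis k x ≠ 0) :
    ‖(isHermitian_add_single hK x v).eigenvectorBasis k y‖ₑ
      ≤ eigenRatio K x y ((isHermitian_add_single hK x v).eigenvalues k)
        * ‖(isHermitian_add_single hK x v).eigenvectorBasis k x‖ₑ := by
  set hA := isHermitian_add_single hK x v
  unfold eigenRatio
  split_ifs with h
  -- The hypothesis ψ(x) ≠ 0 matters here, because ⊤ * 0 = 0.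
  · rw [ENNReal.top_mul (by simpa using hx)]; exact le_top
  · rw [← pinRow_add_single_sub K x (v : ℂ)] at h ⊢
    rw [← enorm_mul]
    refine le_of_eq (congrArg _ ?_)
    refine apply_eq_of_mulVec_eq_zero (fun i _ => ?_) h y
    rw [Matrix.sub_mulVec, hA.mulVec_eigenvectorBasis, Matrix.smul_mulVec, Matrix.one_mulVec]
    simp

/-! ### Eigenfunction correlators and Hölder's inequality. -/

/-- The total mass in `I` of the mixed spectral measure of a Hermitian matrix:
`∑ |ψ_k(x)| |ψ_k(y)|` over the eigenvalues `E_k ∈ I`. -/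
def eigenCorr (hA : A.IsHermitian) (I : Set ℝ) (x y : ι) : ℝ≥0∞ :=
  ∑ k, I.indicator 1 (hA.eigenvalues k) *
    (‖hA.eigenvectorBasis k x‖ₑ * ‖hA.eigenvectorBasis k y‖ₑ)

/-- The energies that are eigenvalues of `K + v |x⟩⟨x|` for some `|v| ≤ M`. -/
def reachable (K : Matrix ι ι ℂ) (x : ι) (M : ℝ) : Set ℝ :=
  {E | ‖(K - (E : ℂ) • (1 : Matrix ι ι ℂ)).det‖ ≤ M * ‖(pinRow (K - (E : ℂ) • 1) x).det‖}

theorem measurableSet_reachable (K : Matrix ι ι ℂ) (x : ι) (M : ℝ) :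
    MeasurableSet (reachable K x M) :=
  measurableSet_le (measurable_det (measurable_sub_smul_one K)).norm
    ((measurable_det (measurable_pinRow_sub_smul_one K x)).norm.const_mul M)

/-- At an eigenvalue the affine determinant vanishes, so det(K - E) equals -v times the pinned
determinant. -/
theorem eigenvalue_mem_reachable {K : Matrix ι ι ℂ} (hK : K.IsHermitian) (x : ι) {v M : ℝ}
    (hv : |v| ≤ M) (k : ι) :
    (isHermitian_add_single hK x v).eigenvalues k ∈ reachable K x M := by
  have h := det_sub_eigenvalue (isHermitian_add_single hK x v) k
  rw [add_sub_right_comm, det_add_single] at h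
  rw [reachable, Set.mem_ofPred_eq, eq_neg_of_add_eq_zero_left h, norm_neg, norm_mul,
    Complex.norm_real]
  exact mul_le_mul_of_nonneg_right hv (norm_nonneg _)

theorem mul_eq_rpow_mul_rpow {s : ℝ} (hs0 : 0 < s) (hs1 : s < 1) (a b : ℝ≥0∞) :
    a * b = (a ^ (2 - s) * b ^ s) ^ (1 / (2 - s)) * (b ^ (2 : ℝ)) ^ (1 / ((2 - s) / (1 - s))) := by
  have h2 : 0 < 2 - s := by linarith
  have h1 : 0 < 1 - s := by linarith
  rw [ENNReal.mul_rpow_of_nonneg _ _ (by positivity), ← ENNReal.rpow_mul,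
    ← ENNReal.rpow_mul, ← ENNReal.rpow_mul, mul_assoc,
    ← ENNReal.rpow_add_of_nonneg _ _ (by positivity) (by positivity),
    mul_one_div_cancel h2.ne', ENNReal.rpow_one]
  have : s * (1 / (2 - s)) + 2 * (1 / ((2 - s) / (1 - s))) = 1 := by
    field_simp
    ring
  rw [this, ENNReal.rpow_one]

theorem holderConjugate_two_sub {s : ℝ} (hs1 : s < 1) :
    (2 - s).HolderConjugate ((2 - s) / (1 - s)) := by
  have h2 : 0 < 2 - s := by linarith
  have h1 : 0 < 1 - s := by linarith
  rw [Real.holderConjugate_iff]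
  refine ⟨by linarith, ?_⟩
  field_simp
  ring

/-- Hölder with exponents 2-s and (2-s)/(1-s): the second factor is a power of ∑ |ψ_k(y)|² = 1 and
disappears. -/
theorem eigenCorr_rpow_le_sum {s : ℝ} (hs0 : 0 < s) (hs1 : s < 1) (hA : A.IsHermitian) (I : Set ℝ)
    (x y : ι) :
    eigenCorr hA I x y ^ (2 - s) ≤ ∑ k, I.indicator 1 (hA.eigenvalues k) *
      (‖hA.eigenvectorBasis k x‖ₑ ^ (2 - s) * ‖hA.eigenvectorBasis k y‖ₑ ^ s) := by
  have h2 : 0 < 2 - s := by linarith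
  have h1 : 0 < 1 - s := by linarith
  set a : ι → ℝ≥0∞ := fun k => ‖hA.eigenvectorBasis k x‖ₑ
  set b : ι → ℝ≥0∞ := fun k => ‖hA.eigenvectorBasis k y‖ₑ
  set c : ι → ℝ≥0∞ := fun k => I.indicator 1 (hA.eigenvalues k)
  have hterm : ∀ k, c k * (a k * b k) = (c k * (a k ^ (2 - s) * b k ^ s)) ^ (1 / (2 - s)) *
      (b k ^ (2 : ℝ)) ^ (1 / ((2 - s) / (1 - s))) := by
    intro k
    by_cases hk : hA.eigenvalues k ∈ I
    · have hc : c k = 1 := Set.indicator_of_mem hk _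
      rw [hc, one_mul, one_mul]
      exact mul_eq_rpow_mul_rpow hs0 hs1 _ _
    · have hc : c k = 0 := Set.indicator_of_notMem hk _
      rw [hc, zero_mul, zero_mul, ENNReal.zero_rpow_of_pos (by positivity), zero_mul]
  have hsum : ∑ k, b k ^ (2 : ℝ) = 1 := by
    simpa using sum_enorm_sq_eigenvectorBasis hA y
  have hH := ENNReal.inner_le_Lp_mul_Lq Finset.univ
    (fun k => (c k * (a k ^ (2 - s) * b k ^ s)) ^ (1 / (2 - s)))
    (fun k => (b k ^ (2 : ℝ)) ^ (1 / ((2 - s) / (1 - s)))) (holderConjugate_two_sub hs1)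
  have hq : 0 < (2 - s) / (1 - s) := by positivity
  simp only [← ENNReal.rpow_mul _ (1 / (2 - s)) (2 - s),
    ← ENNReal.rpow_mul _ (1 / ((2 - s) / (1 - s))) ((2 - s) / (1 - s)),
    one_div_mul_cancel h2.ne', one_div_mul_cancel hq.ne', ENNReal.rpow_one, hsum,
    ENNReal.one_rpow, mul_one] at hH
  calc eigenCorr hA I x y ^ (2 - s) = (∑ k, c k * (a k * b k)) ^ (2 - s) := rfl
    _ ≤ ((∑ k, c k * (a k ^ (2 - s) * b k ^ s)) ^ (1 / (2 - s))) ^ (2 - s) := by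
        simp only [hterm]
        gcongr
    _ = _ := by rw [← ENNReal.rpow_mul, one_div_mul_cancel h2.ne', ENNReal.rpow_one]

/-- Replacing |ψ(y)| by r(E)|ψ(x)| turns |ψ(x)|^(2-s) |ψ(y)|^s into the spectral weight |ψ(x)|²
times r(E)^s. The integrand is the same for all v, as spectral averaging requires. -/
theorem eigenCorr_rpow_le {s : ℝ} (hs0 : 0 < s) (hs1 : s < 1) {K : Matrix ι ι ℂ}
    (hK : K.IsHermitian) (I : Set ℝ) (x y : ι) {v M : ℝ} (hv : |v| ≤ M) :
    eigenCorr (isHermitian_add_single hK x v) I x y ^ (2 - s)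
      ≤ ∫⁻ E, (I ∩ reachable K x M).indicator (fun E => eigenRatio K x y E ^ s) E
        ∂specMeasure (isHermitian_add_single hK x v) x := by
  refine (eigenCorr_rpow_le_sum hs0 hs1 _ I x y).trans ?_
  rw [lintegral_specMeasure]
  refine Finset.sum_le_sum fun k _ => ?_
  by_cases hk : (isHermitian_add_single hK x v).eigenvalues k ∈ I
  swap
  · simp [Set.indicator_of_notMem hk]
  rw [Set.indicator_of_mem hk, Set.indicator_of_mem
    (Set.mem_inter hk (eigenvalue_mem_reachable hK x hv k)), Pi.one_apply, one_mul]
  by_cases hx : (isHermitian_add_single hK x v).eigenvectorBasis k x = 0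
  · rw [hx, enorm_zero, ENNReal.zero_rpow_of_pos (by linarith)]
    simp
  have hb := enorm_eigenvector_le hK x y v k hx
  set a := ‖(isHermitian_add_single hK x v).eigenvectorBasis k x‖ₑ with ha
  have ha0 : a ≠ 0 := by simpa [ha] using hx
  calc a ^ (2 - s) * ‖(isHermitian_add_single hK x v).eigenvectorBasis k y‖ₑ ^ s
      ≤ a ^ (2 - s) *
          (eigenRatio K x y ((isHermitian_add_single hK x v).eigenvalues k) * a) ^ s := by
        gcongr
    _ = a ^ 2 * eigenRatio K x y ((isHermitian_add_single hK x v).eigenvalues k) ^ s := by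
        rw [ENNReal.mul_rpow_of_nonneg _ _ hs0.le, mul_comm (_ ^ s) (a ^ s), ← mul_assoc,
          ← ENNReal.rpow_add _ _ ha0 enorm_ne_top, sub_add_cancel]
        norm_num

/-! ### From eigenvector ratios back to the Green function. -/

theorem ae_det_sub_ne_zero (A : Matrix ι ι ℂ) :
    ∀ᵐ E : ℝ, (A - (E : ℂ) • (1 : Matrix ι ι ℂ)).det ≠ 0 := by
  have hfin : {E : ℝ | (A - (E : ℂ) • (1 : Matrix ι ι ℂ)).det = 0}.Finite := by
    refine (A.finite_spectrum.preimage (f := fun E : ℝ => (E : ℂ))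
      Complex.ofReal_injective.injOn).subset fun E hE => ?_
    rw [Set.mem_preimage, spectrum.mem_iff, Matrix.isUnit_iff_isUnit_det, isUnit_iff_ne_zero,
      not_not, ← neg_sub, Matrix.det_neg, Algebra.algebraMap_eq_smul_one]
    rw [show (A - (E : ℂ) • (1 : Matrix ι ι ℂ)).det = 0 from hE, mul_zero]
  have := hfin.measure_zero volume
  rw [ae_iff]
  simpa using this

/-- A null vector of the pinned matrix vanishes at x, so E is then an eigenvalue of K with row x set
to zero. -/
theorem ae_det_pinRow_ne_zero (K : Matrix ι ι ℂ) (x : ι) :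
    ∀ᵐ E : ℝ, (pinRow (K - (E : ℂ) • (1 : Matrix ι ι ℂ)) x).det ≠ 0 := by
  filter_upwards [ae_det_sub_ne_zero (K.updateRow x 0)] with E hE h0
  apply hE
  rw [← Matrix.exists_mulVec_eq_zero_iff] at h0 ⊢
  obtain ⟨u, hu, hu0⟩ := h0
  refine ⟨u, hu, ?_⟩
  have hux : u x = 0 := by
    simpa [pinRow, Matrix.mulVec] using congrFun hu0 x
  ext i
  by_cases hi : i = x
  · subst hi
    rw [Matrix.sub_mulVec, Matrix.smul_mulVec, Matrix.one_mulVec]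
    simp [hux, Matrix.mulVec]
  · have := congrFun hu0 i
    simp only [pinRow, Matrix.mulVec, Matrix.updateRow_ne hi] at this
    rw [← this]
    simp [Matrix.mulVec, hi, dotProduct, Matrix.sub_apply]

theorem enorm_inv_apply_comm (hA : A.IsHermitian) (x y : ι) : ‖A⁻¹ x y‖ₑ = ‖A⁻¹ y x‖ₑ := by
  have h : (A⁻¹).IsHermitian := hA.inv
  rw [← h.apply x y, ← ofReal_norm, norm_star, ofReal_norm]

omit [Fintype ι] in
theorem isHermitian_sub_smul_one (hA : A.IsHermitian) (E : ℝ) :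
    (A - (E : ℂ) • (1 : Matrix ι ι ℂ)).IsHermitian := by
  refine hA.sub ?_
  rw [Matrix.IsHermitian, Matrix.conjTranspose_smul, Matrix.conjTranspose_one]
  simp

/-- Column x of the resolvent solves the equations off x, so the ratio is |G(y,x)| / |G(x,x)|. The
2M bounds 1/|G(x,x)| = |v - v_E|, with M from |v| and M from reachability of E. -/
theorem eigenRatio_le {K : Matrix ι ι ℂ} (hK : K.IsHermitian) (x y : ι) {v M : ℝ} (hv : |v| ≤ M)
    {E : ℝ} (hE : E ∈ reachable K x M)
    (hB : (pinRow (K - (E : ℂ) • (1 : Matrix ι ι ℂ)) x).det ≠ 0)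
    (hD : (K + Matrix.single x x (v : ℂ) - (E : ℂ) • (1 : Matrix ι ι ℂ)).det ≠ 0) :
    eigenRatio K x y E ≤ ENNReal.ofReal (2 * M) *
      ‖(K + Matrix.single x x (v : ℂ) - (E : ℂ) • (1 : Matrix ι ι ℂ))⁻¹ x y‖ₑ := by
  have hM : 0 ≤ M := (abs_nonneg _).trans hv
  rw [enorm_inv_apply_comm (isHermitian_sub_smul_one (isHermitian_add_single hK x v) E), eigenRatio,
    if_neg hB, ← pinRow_add_single_sub K x (v : ℂ)]
  rw [← pinRow_add_single_sub K x (v : ℂ)] at hB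
  set A := K + Matrix.single x x (v : ℂ) - (E : ℂ) • (1 : Matrix ι ι ℂ) with hAdef
  have hu : ∀ i, i ≠ x → (A.mulVec fun j => A⁻¹ j x) i = 0 := by
    intro i hi
    have := congrFun (congrFun (Matrix.mul_nonsing_inv A (isUnit_iff_ne_zero.2 hD)) i) x
    rw [Matrix.one_apply_ne hi] at this
    exact this
  have h : A⁻¹ y x = (pinRow A x)⁻¹ y x * A⁻¹ x x := apply_eq_of_mulVec_eq_zero hu hB y
  rw [h, inv_apply_self]
  have hdet : ‖A.det‖ ≤ 2 * M * ‖(pinRow A x).det‖ := by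
    have hA' : A.det = (K - (E : ℂ) • 1).det + v * (pinRow A x).det := by
      rw [hAdef, pinRow_add_single_sub, add_sub_right_comm, det_add_single]
    have hE' : ‖(K - (E : ℂ) • (1 : Matrix ι ι ℂ)).det‖ ≤ M * ‖(pinRow A x).det‖ := by
      rw [hAdef, pinRow_add_single_sub]; exact hE
    rw [hA']
    refine (norm_add_le _ _).trans ?_
    rw [norm_mul, Complex.norm_real, Real.norm_eq_abs]
    have := mul_le_mul_of_nonneg_right hv (norm_nonneg (pinRow A x).det)
    linarith
  have hdpos : 0 < ‖A.det‖ := norm_pos_iff.2 hD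
  rw [← ofReal_norm, ← ofReal_norm, ← ENNReal.ofReal_mul (by positivity)]
  refine ENNReal.ofReal_le_ofReal ?_
  rw [norm_mul, norm_div]
  have : 1 ≤ 2 * M * (‖(pinRow A x).det‖ / ‖A.det‖) := by
    rw [← mul_div_assoc, le_div_iff₀ hdpos, one_mul]; exact hdet
  calc ‖(pinRow A x)⁻¹ y x‖ = ‖(pinRow A x)⁻¹ y x‖ * 1 := (mul_one _).symm
    _ ≤ ‖(pinRow A x)⁻¹ y x‖ * (2 * M * (‖(pinRow A x).det‖ / ‖A.det‖)) := by gcongr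
    _ = _ := by ring

/-- The left side is free of v, so v on the right may be any admissible value and can be averaged
again. -/
theorem lintegral_eigenRatio_le {s : ℝ} (hs0 : 0 < s) {K : Matrix ι ι ℂ} (hK : K.IsHermitian)
    {I : Set ℝ} (hI : MeasurableSet I) (x y : ι) {v M : ℝ} (hv : |v| ≤ M) :
    ∫⁻ E, (I ∩ reachable K x M).indicator (fun E => eigenRatio K x y E ^ s) E
      ≤ ENNReal.ofReal (2 * M) ^ s * ∫⁻ E in I,
        ‖(K + Matrix.single x x (v : ℂ) - (E : ℂ) • (1 : Matrix ι ι ℂ))⁻¹ x y‖ₑ ^ s := by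
  rw [← lintegral_const_mul' _ _ (by finiteness), ← lintegral_indicator hI]
  refine lintegral_mono_ae ?_
  filter_upwards [ae_det_pinRow_ne_zero K x,
    ae_det_sub_ne_zero (K + Matrix.single x x (v : ℂ))] with E hB hD
  by_cases hE : E ∈ I ∩ reachable K x M
  · rw [Set.indicator_of_mem hE, Set.indicator_of_mem hE.1, ← ENNReal.mul_rpow_of_nonneg _ _ hs0.le]
    exact ENNReal.rpow_le_rpow (eigenRatio_le hK x y hv hE.2 hB hD) hs0.le
  · rw [Set.indicator_of_notMem hE]; exact zero_le

/-- The rank-one averaging bound for a single-site distribution `κ`. -/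
theorem lintegral_eigenCorr_rpow_le {s : ℝ} (hs0 : 0 < s) (hs1 : s < 1) {K : Matrix ι ι ℂ}
    (hK : K.IsHermitian) {I : Set ℝ} (hI : MeasurableSet I) (x y : ι) {κ : Measure ℝ}
    [IsProbabilityMeasure κ] {M : ℝ} {N : ℝ≥0} (hM : ∀ᵐ v ∂κ, |v| ≤ M) (hN : κ ≤ N • volume) :
    ∫⁻ v, eigenCorr (isHermitian_add_single hK x v) I x y ^ (2 - s) ∂κ
      ≤ N * ENNReal.ofReal (2 * M) ^ s * ∫⁻ v : ℝ, (∫⁻ E in I,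
        ‖(K + Matrix.single x x (v : ℂ) - (E : ℂ) • (1 : Matrix ι ι ℂ))⁻¹ x y‖ₑ ^ s) ∂κ := by
  set f : ℝ → ℝ≥0∞ := (I ∩ reachable K x M).indicator (fun E => eigenRatio K x y E ^ s) with hf
  have hfm : Measurable f := ((measurable_eigenRatio K x y).pow_const s).indicator
    (hI.inter (measurableSet_reachable K x M))
  calc ∫⁻ v, eigenCorr (isHermitian_add_single hK x v) I x y ^ (2 - s) ∂κ
      ≤ ∫⁻ v, (∫⁻ E, f E ∂specMeasure (isHermitian_add_single hK x v) x) ∂κ := by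
        refine lintegral_mono_ae ?_
        filter_upwards [hM] with v hv
        exact eigenCorr_rpow_le hs0 hs1 hK I x y hv
    _ ≤ ∫⁻ v, (∫⁻ E, f E ∂specMeasure (isHermitian_add_single hK x v) x) ∂(N • volume) :=
        lintegral_mono' hN le_rfl
    _ = N * ∫⁻ v, ∫⁻ E, f E ∂specMeasure (isHermitian_add_single hK x v) x := by
        rw [lintegral_smul_measure]; rfl
    _ ≤ N * ∫⁻ E, f E := by gcongr 1; exact lintegral_lintegral_specMeasure_le hK x hfm
    -- The first average over v was spent on spectral averaging; κ has mass 1, so a fresh one can be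
    -- inserted.
    _ = N * ∫⁻ _, (∫⁻ E, f E) ∂κ := by rw [lintegral_const, measure_univ, mul_one]
    _ ≤ N * ∫⁻ v : ℝ, ENNReal.ofReal (2 * M) ^ s * (∫⁻ E in I,
        ‖(K + Matrix.single x x (v : ℂ) - (E : ℂ) • (1 : Matrix ι ι ℂ))⁻¹ x y‖ₑ ^ s) ∂κ := by
        gcongr 1
        refine lintegral_mono_ae ?_
        filter_upwards [hM] with v hv
        exact lintegral_eigenRatio_le hs0 hK hI x y hv
    _ = _ := by rw [lintegral_const_mul' _ _ (by finiteness), mul_assoc]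

/-! ### Independent diagonal disorder -/

/-- `K` plus the diagonal matrix with entries `W`. -/
def addPotential (K : Matrix ι ι ℂ) (W : ι → ℝ) : Matrix ι ι ℂ :=
  K + Matrix.diagonal fun i => (W i : ℂ)

omit [Fintype ι] in
theorem isHermitian_addPotential {K : Matrix ι ι ℂ} (hK : K.IsHermitian) (W : ι → ℝ) :
    (addPotential K W).IsHermitian := by
  refine hK.add ?_
  rw [Matrix.isHermitian_diagonal_iff]
  intro i
  simp [isSelfAdjoint_iff]

omit [Fintype ι] in
theorem addPotential_update (K : Matrix ι ι ℂ) (W : ι → ℝ) (x : ι) (v : ℝ) :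
    addPotential K (Function.update W x v)
      = addPotential K (Function.update W x 0) + Matrix.single x x (v : ℂ) := by
  ext i j
  by_cases hi : i = x
  · subst hi
    by_cases hj : i = j
    · subst hj; simp [addPotential]
    · simp [addPotential, hj, Matrix.single]
  · simp [addPotential, Matrix.diagonal_apply, hi, Matrix.single, Ne.symm hi]

omit [Fintype ι] in
theorem measurable_addPotential (K : Matrix ι ι ℂ) (i j : ι) :
    Measurable fun W : ι → ℝ => addPotential K W i j := by
  simp only [addPotential, Matrix.add_apply, Matrix.diagonal_apply]
  refine measurable_const.add ?_
  split_ifs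
  · exact Complex.measurable_ofReal.comp (measurable_pi_apply i)
  · exact measurable_const

theorem measurable_green (K : Matrix ι ι ℂ) (x y : ι) :
    Measurable fun q : (ι → ℝ) × ℝ =>
      ‖(addPotential K q.1 - (q.2 : ℂ) • (1 : Matrix ι ι ℂ))⁻¹ x y‖ₑ := by
  refine (measurable_inv (fun i j => ?_) x y).enorm
  simp only [Matrix.sub_apply, Matrix.smul_apply]
  exact ((measurable_addPotential K i j).comp measurable_fst).sub
    ((Complex.measurable_ofReal.comp measurable_snd).smul_const _)

/-- The finite-volume correlator is bounded by fractional moments of the Green function. -/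
theorem lintegral_le_green {s : ℝ} (hs0 : 0 < s) (hs1 : s < 1) {K : Matrix ι ι ℂ}
    (hK : K.IsHermitian) {I : Set ℝ} (hI : MeasurableSet I) (x y : ι) {κ : Measure ℝ}
    [IsProbabilityMeasure κ] {M : ℝ} {N : ℝ≥0} (hM : ∀ᵐ v ∂κ, |v| ≤ M) (hN : κ ≤ N • volume)
    {G : (ι → ℝ) → ℝ≥0∞} (hG : Measurable G)
    (hGle : ∀ W, G W ≤ eigenCorr (isHermitian_addPotential hK W) I x y) :
    ∫⁻ W, G W ∂Measure.pi (fun _ : ι => κ)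
      ≤ (N * ENNReal.ofReal (2 * M) ^ s) ^ (1 / (2 - s)) * (∫⁻ E in I, ∫⁻ W,
        ‖(addPotential K W - (E : ℂ) • (1 : Matrix ι ι ℂ))⁻¹ x y‖ₑ ^ s
          ∂Measure.pi (fun _ : ι => κ)) ^ (1 / (2 - s)) := by
  have h2 : 0 < 2 - s := by linarith
  have hm : Measurable fun q : (ι → ℝ) × ℝ =>
      ‖(addPotential K q.1 - (q.2 : ℂ) • (1 : Matrix ι ι ℂ))⁻¹ x y‖ₑ ^ s :=
    (measurable_green K x y).pow_const s
  have hR : Measurable fun W : ι → ℝ => ∫⁻ E in I,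
      ‖(addPotential K W - (E : ℂ) • (1 : Matrix ι ι ℂ))⁻¹ x y‖ₑ ^ s := hm.lintegral_prod_right'
  have hmain : ∫⁻ W, G W ^ (2 - s) ∂Measure.pi (fun _ : ι => κ)
      ≤ ∫⁻ W, N * ENNReal.ofReal (2 * M) ^ s * (∫⁻ E in I,
        ‖(addPotential K W - (E : ℂ) • (1 : Matrix ι ι ℂ))⁻¹ x y‖ₑ ^ s)
          ∂Measure.pi (fun _ : ι => κ) := by
    -- It suffices to compare the integrals over the single coordinate at x, all other sites being
    -- frozen.
    refine lintegral_le_of_lmarginal_le {x} (hG.pow_const _) (hR.const_mul _) fun W => ?_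
    simp only [lmarginal_singleton]
    have hK' := isHermitian_addPotential hK (Function.update W x 0)
    have h := lintegral_eigenCorr_rpow_le hs0 hs1 hK' hI x y hM hN
    rw [lintegral_const_mul' _ _ (by finiteness)]
    refine le_trans (lintegral_mono fun v => ?_) (h.trans (le_of_eq ?_))
    swap
    · congr 1
      refine lintegral_congr fun v => ?_
      rw [addPotential_update K W x v]
    refine ENNReal.rpow_le_rpow ((hGle _).trans (le_of_eq ?_)) h2.le
    congr 1
    exact addPotential_update K W x v
  -- Jensen for the power 2-s, obtained as Hölder against the constant 1.
  have hJ : ∫⁻ W, G W ∂Measure.pi (fun _ : ι => κ)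
      ≤ (∫⁻ W, G W ^ (2 - s) ∂Measure.pi (fun _ : ι => κ)) ^ (1 / (2 - s)) := by
    have h := ENNReal.lintegral_mul_le_Lp_mul_Lq (Measure.pi (fun _ : ι => κ))
      (holderConjugate_two_sub hs1) hG.aemeasurable (aemeasurable_const (b := (1 : ℝ≥0∞)))
    simpa using h
  refine hJ.trans ((ENNReal.rpow_le_rpow hmain (by positivity)).trans (le_of_eq ?_))
  rw [lintegral_const_mul' _ _ (by finiteness), ENNReal.mul_rpow_of_nonneg _ _ (by positivity),
    lintegral_lintegral_swap (by exact hm.aemeasurable)]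

end HermitianMatrix

/-! ### Variation of a complex measure tested against continuous functions -/

section Variation

/-- Families of `n` continuous functions `ℝ → [0, 1]` vanishing outside `U`, no two of which are
nonzero at the same point. -/
def testFamilies (U : Set ℝ) (n : ℕ) : Set (Fin n → C(ℝ, ℝ)) :=
  {F | (∀ i t, 0 ≤ F i t ∧ F i t ≤ 1) ∧ (∀ i, ∀ t ∉ U, F i t = 0) ∧
    ∀ i j, i ≠ j → ∀ t, F i t = 0 ∨ F j t = 0}

variable {J : Type*} [Fintype J] (ν : J → Measure ℝ) [∀ j, IsFiniteMeasure (ν j)] (c : J → ℂ)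

theorem integrable_of_mem_Icc {m : Measure ℝ} [IsFiniteMeasure m] {f : C(ℝ, ℝ)}
    (hf : ∀ t, 0 ≤ f t ∧ f t ≤ 1) : Integrable (fun t => f t) m :=
  Integrable.of_bound f.continuous.aestronglyMeasurable 1
    (Eventually.of_forall fun t => by rw [Real.norm_of_nonneg (hf t).1]; exact (hf t).2)

/-- Layer cake: each integral is ∫ μ{F_i > r} dr over r > 0. At each level the superlevel sets are
disjoint subsets of U, and they are empty for r ≥ 1. -/
theorem sum_enorm_integral_le_variation {μ : ComplexMeasure ℝ}
    (hμ : ∀ B, MeasurableSet B → μ B = ∑ j, c j * ((ν j).real B : ℂ)) {U : Set ℝ} {n : ℕ}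
    {F : Fin n → C(ℝ, ℝ)} (hF : F ∈ testFamilies U n) :
    ∑ i, ‖∑ j, c j * ((∫ t, F i t ∂ν j : ℝ) : ℂ)‖ₑ ≤ μ.variation U := by
  obtain ⟨hF1, hF2, hF3⟩ := hF
  have hmeas : ∀ i (r : ℝ), MeasurableSet {t | r < F i t} := fun i r =>
    measurableSet_lt measurable_const (F i).continuous.measurable
  have hanti : ∀ i j, Antitone fun r : ℝ => (ν j).real {t | r < F i t} := fun i j r r' hr =>
    measureReal_mono fun t ht => lt_of_le_of_lt hr ht
  have hempty : ∀ i (r : ℝ), 1 ≤ r → {t | r < F i t} = ∅ := fun i r hr =>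
    Set.eq_empty_of_forall_notMem fun t ht => absurd ((hr.trans_lt ht).trans_le (hF1 i t).2)
      (lt_irrefl _)
  have hint : ∀ i j, IntegrableOn (fun r : ℝ => (ν j).real {t | r < F i t}) (Set.Ioi 0) := by
    intro i j
    have h1 : IntegrableOn (fun r : ℝ => (ν j).real {t | r < F i t}) (Set.Ioc 0 1) := by
      refine Measure.integrableOn_of_bounded (M := (ν j).real Set.univ) (by simp)
        (hanti i j).measurable.aestronglyMeasurable ?_
      exact Eventually.of_forall fun r => by
        rw [Real.norm_of_nonneg measureReal_nonneg]; exact measureReal_mono (Set.subset_univ _)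
    rw [← Set.Ioc_union_Ioi_eq_Ioi zero_le_one]
    refine h1.union (IntegrableOn.congr_fun (integrableOn_zero (ε' := ℝ)) (fun r hr => ?_)
      measurableSet_Ioi)
    simp [hempty i r (le_of_lt hr)]
  have hlayer : ∀ i, ∑ j, c j * ((∫ t, F i t ∂ν j : ℝ) : ℂ)
      = ∫ r in Set.Ioi (0 : ℝ), μ {t | r < F i t} := by
    intro i
    have : ∀ j, c j * ((∫ t, F i t ∂ν j : ℝ) : ℂ)
        = ∫ r in Set.Ioi (0 : ℝ), c j * (((ν j).real {t | r < F i t} : ℝ) : ℂ) := by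
      intro j
      rw [(integrable_of_mem_Icc (hF1 i)).integral_eq_integral_meas_lt
        (Eventually.of_forall fun t => (hF1 i t).1), integral_const_mul, integral_complex_ofReal]
    simp only [this, hμ _ (hmeas i _)]
    rw [integral_finsetSum]
    exact fun j _ => ((hint i j).ofReal (𝕜 := ℂ)).const_mul (c j)
  have hmeasμ : ∀ i, Measurable fun r : ℝ => ‖μ {t | r < F i t}‖ₑ := by
    intro i
    simp only [hμ _ (hmeas i _)]
    exact (Finset.measurable_sum _ fun j _ => (Complex.measurable_ofReal.comp
      (hanti i j).measurable).const_mul (c j)).enorm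
  calc ∑ i, ‖∑ j, c j * ((∫ t, F i t ∂ν j : ℝ) : ℂ)‖ₑ
      ≤ ∑ i, ∫⁻ r in Set.Ioi (0 : ℝ), ‖μ {t | r < F i t}‖ₑ := by
        refine Finset.sum_le_sum fun i _ => ?_
        rw [hlayer]
        exact enorm_integral_le_lintegral_enorm _
    _ = ∫⁻ r in Set.Ioi (0 : ℝ), ∑ i, ‖μ {t | r < F i t}‖ₑ :=
        (lintegral_finsetSum _ fun i _ => hmeasμ i).symm
    _ ≤ ∫⁻ r in Set.Ioi (0 : ℝ), (Set.Iio 1).indicator (fun _ => μ.variation U) r := by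
        refine setLIntegral_mono' measurableSet_Ioi fun r hr => ?_
        by_cases h1 : r < 1
        · rw [Set.indicator_of_mem (show r ∈ Set.Iio 1 from h1)]
          calc ∑ i, ‖μ {t | r < F i t}‖ₑ ≤ ∑ i, μ.variation {t | r < F i t} :=
                Finset.sum_le_sum fun i _ => VectorMeasure.enorm_measure_le_variation _ _
            _ = μ.variation (⋃ i ∈ Finset.univ, {t | r < F i t}) := by
                refine (measure_biUnion_finset (fun i _ j _ hij => ?_) fun i _ => hmeas i r).symm
                refine Set.disjoint_left.2 fun t hi hj => ?_
                have hr0 : (0 : ℝ) < r := hr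
                rcases hF3 i j hij t with h | h
                · have : r < F i t := hi
                  linarith
                · have : r < F j t := hj
                  linarith
            _ ≤ μ.variation U := by
                refine measure_mono (Set.iUnion₂_subset fun i _ t ht => ?_)
                by_contra hU
                have hr0 : (0 : ℝ) < r := hr
                have : r < F i t := ht
                rw [hF2 i t hU] at this
                linarith
        · simp [hempty _ r (not_lt.1 h1)]
    _ = μ.variation U := by
        rw [lintegral_indicator measurableSet_Iio, Measure.restrict_restrict measurableSet_Iio,
          setLIntegral_const, Set.inter_comm, Set.Ioi_inter_Iio]
        simp

theorem exists_isCompact_approx (B : Set ℝ) (hB : MeasurableSet B) :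
    ∃ K : ℕ → Set ℝ, (∀ n, K n ⊆ B) ∧ (∀ n, IsCompact (K n)) ∧
      ∀ j, Tendsto (fun n => (ν j).real (K n)) atTop (𝓝 ((ν j).real B)) := by
  -- Inner regularity of the sum gives compact sets that work for all `ν j` simultaneously.
  set m : Measure ℝ := ∑ j, ν j with hm
  have h : ∀ n : ℕ, ∃ K ⊆ B, IsCompact K ∧ m (B \ K) < ENNReal.ofReal (1 / ((n : ℝ) + 1)) :=
    fun n => hB.exists_isCompact_sdiff_lt (measure_ne_top m B)
      (by simpa using by positivity)
  choose K hKB hKc hK using h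
  refine ⟨K, hKB, hKc, fun j => ?_⟩
  rw [tendsto_iff_norm_sub_tendsto_zero]
  refine squeeze_zero (fun _ => norm_nonneg _) (fun n => ?_)
    tendsto_one_div_add_atTop_nhds_zero_nat
  rw [norm_sub_rev, ← measureReal_sdiff (hKB n) (hKc n).measurableSet,
    Real.norm_of_nonneg measureReal_nonneg]
  refine ENNReal.toReal_le_of_le_ofReal (by positivity) (le_trans ?_ (hK n).le)
  exact (Finset.single_le_sum (f := ν) (fun _ _ => Measure.zero_le _) (Finset.mem_univ j)) _

/-- Disjoint compact subsets of U have small thickenings that are still disjoint and inside U. The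
thickened indicators live there and converge to the indicators. -/
theorem exists_testFamily_of_isCompact {U : Set ℝ} (hU : IsOpen U) {n : ℕ} {K : Fin n → Set ℝ}
    (hKc : ∀ i, IsCompact (K i)) (hKU : ∀ i, K i ⊆ U) (hKd : ∀ i j, i ≠ j → Disjoint (K i) (K j))
    {a : ℝ≥0∞} (ha : a < ∑ i, ‖∑ j, c j * ((ν j).real (K i) : ℂ)‖ₑ) :
    ∃ F ∈ testFamilies U n, a < ∑ i, ‖∑ j, c j * ((∫ t, F i t ∂ν j : ℝ) : ℂ)‖ₑ := by
  have hpos : ∀ m : ℕ, (0 : ℝ) < 1 / ((m : ℝ) + 1) := fun m => by positivity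
  have hlim : Tendsto (fun m : ℕ => 1 / ((m : ℝ) + 1)) atTop (𝓝 0) :=
    tendsto_one_div_add_atTop_nhds_zero_nat
  set F : ℕ → Fin n → C(ℝ, ℝ) := fun m i =>
    ⟨fun t => ((thickenedIndicator (hpos m) (K i) t : ℝ≥0) : ℝ), by fun_prop⟩ with hFdef
  have hconv : Tendsto (fun m => ∑ i, ‖∑ j, c j * ((∫ t, F m i t ∂ν j : ℝ) : ℂ)‖ₑ) atTop
      (𝓝 (∑ i, ‖∑ j, c j * ((ν j).real (K i) : ℂ)‖ₑ)) := by
    refine tendsto_finsetSum _ fun i _ => (continuous_enorm.tendsto _).comp ?_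
    refine tendsto_finsetSum _ fun j _ => Tendsto.const_mul _ ?_
    exact (Complex.continuous_ofReal.tendsto _).comp
      (tendsto_integral_thickenedIndicator_of_isClosed (ν j) (hKc i).isClosed hpos hlim)
  have hzero : ∀ (m : ℕ) i t, t ∉ Metric.thickening (1 / ((m : ℝ) + 1)) (K i) → F m i t = 0 := by
    intro m i t ht
    simp only [hFdef, ContinuousMap.coe_mk, thickenedIndicator_zero (hpos m) (K i) ht,
      NNReal.coe_zero]
  have hsub : ∀ᶠ m : ℕ in atTop, ∀ i, Metric.thickening (1 / ((m : ℝ) + 1)) (K i) ⊆ U := by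
    refine eventually_all.2 fun i => ?_
    obtain ⟨δ, hδ, h⟩ := (hKc i).exists_thickening_subset_open hU (hKU i)
    filter_upwards [hlim.eventually (gt_mem_nhds hδ)] with m hm
    exact (Metric.thickening_mono hm.le _).trans h
  have hdisj : ∀ᶠ m : ℕ in atTop, ∀ i j, i ≠ j →
      Disjoint (Metric.thickening (1 / ((m : ℝ) + 1)) (K i))
        (Metric.thickening (1 / ((m : ℝ) + 1)) (K j)) := by
    refine eventually_all.2 fun i => eventually_all.2 fun j => ?_
    by_cases hij : i = j
    · exact Eventually.of_forall fun _ h => absurd hij h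
    obtain ⟨δ, hδ, h⟩ := (hKd i j hij).exists_thickenings (hKc i) (hKc j).isClosed
    filter_upwards [hlim.eventually (gt_mem_nhds hδ)] with m hm _
    exact h.mono (Metric.thickening_mono hm.le _) (Metric.thickening_mono hm.le _)
  obtain ⟨m, h1, h2, h3⟩ := (hsub.and (hdisj.and (hconv.eventually (lt_mem_nhds ha)))).exists
  refine ⟨F m, ⟨fun i t => ⟨NNReal.coe_nonneg _, ?_⟩, fun i t ht => ?_, fun i j hij t => ?_⟩, h3⟩
  · exact NNReal.coe_le_one.2 (thickenedIndicator_le_one (hpos m) (K i) t)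
  · exact hzero m i t fun h => ht (h1 i h)
  · by_cases ht : t ∈ Metric.thickening (1 / ((m : ℝ) + 1)) (K i)
    · exact Or.inr (hzero m j t (Set.disjoint_left.1 (h2 i j hij) ht))
    · exact Or.inl (hzero m i t ht)

theorem variation_eq_iSup {μ : ComplexMeasure ℝ}
    (hμ : ∀ B, MeasurableSet B → μ B = ∑ j, c j * ((ν j).real B : ℂ)) {U : Set ℝ}
    (hU : IsOpen U) :
    μ.variation U = ⨆ n, ⨆ F ∈ testFamilies U n,
      ∑ i, ‖∑ j, c j * ((∫ t, F i t ∂ν j : ℝ) : ℂ)‖ₑ := by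
  refine le_antisymm ?_ (iSup_le fun n => iSup₂_le fun F hF =>
    sum_enorm_integral_le_variation ν c hμ hF)
  refine le_of_forall_lt fun a ha => ?_
  obtain ⟨P, hPU, hPd, hPm, hP⟩ := μ.exists_lt_sum_of_lt_variation hU.measurableSet ha
  set B : Fin P.card → Set ℝ := fun i => (P.equivFin.symm i : Set ℝ) with hB
  have hBm : ∀ i, MeasurableSet (B i) := fun i => hPm _ (P.equivFin.symm i).2
  have hsum : ∑ p ∈ P, ‖μ p‖ₑ = ∑ i, ‖∑ j, c j * ((ν j).real (B i) : ℂ)‖ₑ := by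
    rw [← P.sum_coe_sort, ← P.equivFin.symm.sum_comp]
    exact Finset.sum_congr rfl fun i _ => by rw [hμ _ (hPm _ (P.equivFin.symm i).2)]
  rw [hsum] at hP
  choose K hKB hKc hK using fun i => exists_isCompact_approx ν (B i) (hBm i)
  have hconv : Tendsto (fun m => ∑ i, ‖∑ j, c j * ((ν j).real (K i m) : ℂ)‖ₑ) atTop
      (𝓝 (∑ i, ‖∑ j, c j * ((ν j).real (B i) : ℂ)‖ₑ)) := by
    refine tendsto_finsetSum _ fun i _ => (continuous_enorm.tendsto _).comp ?_
    refine tendsto_finsetSum _ fun j _ => Tendsto.const_mul _ ?_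
    exact (Complex.continuous_ofReal.tendsto _).comp (hK i j)
  obtain ⟨m, hm⟩ := (hconv.eventually (lt_mem_nhds hP)).exists
  obtain ⟨F, hF, hlt⟩ := exists_testFamily_of_isCompact ν c hU (K := fun i => K i m)
    (fun i => hKc i m) (fun i => (hKB i m).trans (hPU _ (P.equivFin.symm i).2))
    (fun i j hij => (hPd (P.equivFin.symm i).2 (P.equivFin.symm j).2 (by
      intro h; exact hij (P.equivFin.symm.injective (Subtype.ext h)))).mono (hKB i m) (hKB j m)) hm
  exact hlt.trans_le (le_iSup_of_le _ (le_iSup₂_of_le F hF le_rfl))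

end Variation

/-! ### Variation of mixed spectral measures through matrix elements. -/

section MixedSpectral

variable {H : Type*} [NormedAddCommGroup H] [InnerProductSpace ℂ H] [CompleteSpace H]

/-- The matrix element `⟨φ, f(T) ψ⟩`. -/
def funElement (T : H →L[ℂ] H) (φ ψ : H) (f : C(ℝ, ℝ)) : ℂ :=
  inner ℂ φ (cfc (fun t : ℝ => f t) T ψ)

/-- The spectrum lies within radius ‖T‖ ‖1‖; the second factor allows for the zero space, where ‖1‖
= 0. -/
theorem norm_inner_aeval_sub_funElement_le {T : H →L[ℂ] H} (hT : IsSelfAdjoint T) (φ ψ : H)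
    (f : C(ℝ, ℝ)) (p : Polynomial ℝ) {R ε : ℝ} (hR : ‖T‖ * ‖(1 : H →L[ℂ] H)‖ ≤ R) (hε : 0 ≤ ε)
    (hp : ∀ t ∈ Set.Icc (-R) R, |p.eval t - f t| ≤ ε) :
    ‖inner ℂ φ (Polynomial.aeval T p ψ) - funElement T φ ψ f‖ ≤ ‖φ‖ * (ε * ‖ψ‖) := by
  have hsub : Polynomial.aeval T p - cfc (fun t : ℝ => f t) T
      = cfc (fun t : ℝ => p.eval t - f t) T := by
    rw [cfc_sub (fun t : ℝ => p.eval t) (fun t => f t) T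
      p.continuous.continuousOn f.continuous.continuousOn, cfc_polynomial p T hT]
  have hn : ‖cfc (fun t : ℝ => p.eval t - f t) T‖ ≤ ε := by
    refine norm_cfc_le hε fun t ht => hp t ?_
    have := spectrum.norm_le_norm_mul_of_mem ht
    rw [Set.mem_Icc, ← abs_le]
    exact this.trans hR
  rw [funElement, ← inner_sub_right, ← sub_apply, hsub]
  exact (norm_inner_le_norm _ _).trans (by
    gcongr
    exact (ContinuousLinearMap.le_opNorm _ _).trans (by gcongr))

theorem variation_mixedSpectralMeasure_eq_iSup (T : H →L[ℂ] H) (φ ψ : H) (a b : ℝ) :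
    (mixedSpectralMeasure T φ ψ).variation (Set.Ioo a b)
      = ⨆ n, ⨆ F ∈ testFamilies (Set.Ioo a b) n,
        ∑ i, ‖funElement T φ ψ (F i)‖ₑ := by
  set ν : Fin 4 → Measure ℝ := ![spectralMeasure T (φ + ψ), spectralMeasure T (φ - ψ),
    spectralMeasure T (φ - Complex.I • ψ), spectralMeasure T (φ + Complex.I • ψ)] with hν
  set c : Fin 4 → ℂ := ![1 / 4, -(1 / 4), 1 / 4 * Complex.I, -(1 / 4 * Complex.I)] with hc
  have hfin : ∀ j, IsFiniteMeasure (ν j) := by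
    intro j
    fin_cases j <;> simp only [hν] <;> exact isFiniteMeasure_spectralMeasure T _
  have hμ : ∀ B, MeasurableSet B →
      mixedSpectralMeasure T φ ψ B = ∑ j, c j * ((ν j).real B : ℂ) := by
    intro B hB
    rw [mixedSpectralMeasure, SignedMeasure.toComplexMeasure_apply]
    simp only [Fin.sum_univ_four, hν, hc, _root_.smul_apply, _root_.sub_apply,
      Measure.toSignedMeasure_apply_measurable hB, smul_eq_mul]
    apply Complex.ext <;> simp <;> ring
  rw [variation_eq_iSup ν c hμ isOpen_Ioo]
  refine iSup_congr fun n => iSup_congr fun F => iSup_congr fun hF =>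
    Finset.sum_congr rfl fun i _ => ?_
  -- Boundedness of the interval makes every test function compactly supported.
  have hcs : HasCompactSupport (F i) := HasCompactSupport.intro isCompact_Icc
    (fun t ht => hF.2.1 i t fun h => ht (Set.Ioo_subset_Icc_self h))
  have hspec := mixedSpectralMeasure_spec T φ ψ ⟨F i, hcs⟩
  congr 1
  refine Eq.trans ?_ hspec
  simp only [Fin.sum_univ_four, hν, hc]
  push_cast
  simp
  ring

theorem continuous_funElement (T : H →L[ℂ] H) (φ ψ : H) :
    Continuous fun f : C(ℝ, ℝ) => funElement T φ ψ f := by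
  have h : Continuous fun f : C(ℝ, ℝ) => cfc (fun t : ℝ => f t) T := by
    refine continuous_iff_continuousAt.2 fun f => continuousAt_cfc_fun ?_
      (Eventually.of_forall fun g => g.continuous.continuousOn)
    exact ContinuousMap.tendsto_iff_forall_isCompact_tendstoUniformlyOn.1 tendsto_id _
      (spectrum.isCompact T)
  exact continuous_const.inner (h.clm_apply continuous_const)

/-- Subsets of C(ℝ, ℝ)^n are separable and matrix elements are continuous in f, so a countable dense
set of families attains the supremum. It is the same for all operators, hence for all realizations
of the disorder. -/
theorem exists_countable_variation_eq_iSup (a b : ℝ) :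
    ∃ 𝓕 : Set (Σ n, Fin n → C(ℝ, ℝ)), 𝓕.Countable ∧
      (∀ F ∈ 𝓕, F.2 ∈ testFamilies (Set.Ioo a b) F.1) ∧
      ∀ (T : H →L[ℂ] H) (φ ψ : H), (mixedSpectralMeasure T φ ψ).variation (Set.Ioo a b)
        = ⨆ F ∈ 𝓕, ∑ i, ‖funElement T φ ψ (F.2 i)‖ₑ := by
  choose D hDc hDd using fun n =>
    TopologicalSpace.exists_countable_dense (testFamilies (Set.Ioo a b) n)
  refine ⟨⋃ n, (fun F : testFamilies (Set.Ioo a b) n => (⟨n, F.1⟩ : Σ n, Fin n → C(ℝ, ℝ))) '' D n,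
    Set.countable_iUnion fun n => (hDc n).image _, ?_, fun T φ ψ => ?_⟩
  · intro F hF
    obtain ⟨n, G, -, rfl⟩ := Set.mem_iUnion.1 hF
    exact G.2
  rw [variation_mixedSpectralMeasure_eq_iSup, iSup_iUnion]
  refine iSup_congr fun n => ?_
  set g : testFamilies (Set.Ioo a b) n → ℝ≥0∞ := fun F =>
    ∑ i, ‖funElement T φ ψ (F.1 i)‖ₑ with hg
  have hcont : Continuous g := by
    refine continuous_finsetSum _ fun i _ => ?_
    exact continuous_enorm.comp ((continuous_funElement T φ ψ).comp
      ((continuous_apply i).comp continuous_subtype_val))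
  have hcl : IsClosed {F | g F ≤ ⨆ G ∈ D n, g G} := isClosed_le hcont continuous_const
  have hle : ∀ F, g F ≤ ⨆ G ∈ D n, g G := fun F =>
    hcl.closure_subset_iff.2 (fun G hG => le_iSup₂ (f := fun G (_ : G ∈ D n) => g G) G hG)
      (hDd n F)
  have himg : (⨆ F ∈ (fun F : testFamilies (Set.Ioo a b) n =>
      (⟨n, F.1⟩ : Σ n, Fin n → C(ℝ, ℝ))) '' D n,
      ∑ i, ‖funElement T φ ψ (F.2 i)‖ₑ) = ⨆ G ∈ D n, g G := iSup_image
  rw [himg]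
  exact le_antisymm (iSup₂_le fun F hF => hle ⟨F, hF⟩)
    (iSup₂_le fun G _ => le_iSup₂_of_le G.1 G.2 le_rfl)

end MixedSpectral

/-! ### Infinite-volume limit -/

section InfiniteVolume

variable {d : ℕ}

theorem exists_eq_single_of_sum_abs_eq_one {k : Fin d → ℤ} (hk : ∑ i, |k i| = 1) :
    ∃ j, k = Pi.single j 1 ∨ k = -Pi.single j 1 := by
  obtain ⟨j, -, hj⟩ := Finset.exists_ne_zero_of_sum_ne_zero (hk.trans_ne one_ne_zero)
  rw [← Finset.add_sum_erase _ _ (Finset.mem_univ j)] at hk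
  have h1 : 1 ≤ |k j| := Int.one_le_abs (by simpa using hj)
  have h0 : 0 ≤ ∑ i ∈ Finset.univ.erase j, |k i| := Finset.sum_nonneg fun _ _ => abs_nonneg _
  have hsum : ∑ i ∈ Finset.univ.erase j, |k i| = 0 := by linarith
  have hrest : ∀ i, i ≠ j → k i = 0 := fun i hi => by
    have := (Finset.sum_eq_zero_iff_of_nonneg fun _ _ => abs_nonneg _).1 hsum i (by simp [hi])
    simpa using this
  have hkj : |k j| = 1 := by linarith
  refine ⟨j, ?_⟩
  rcases abs_eq (zero_le_one) |>.1 hkj with h | h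
  · left
    ext i
    by_cases hi : i = j
    · subst hi; simp [h]
    · simp [hi, hrest i hi]
  · right
    ext i
    by_cases hi : i = j
    · subst hi; simp [h]
    · simp [hi, hrest i hi]

theorem sum_abs_single (j : Fin d) : ∑ i, |(Pi.single j 1 : Fin d → ℤ) i| = 1 := by
  rw [Finset.sum_eq_single j] <;> simp +contextual

theorem sum_neighbours (n m : Fin d → ℤ) :
    ∑ j : Fin d, ((if n + Pi.single j 1 = m then (1 : ℂ) else 0)
      + (if n - Pi.single j 1 = m then 1 else 0)) = if ∑ i, |n i - m i| = 1 then 1 else 0 := by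
  have hne : ∀ i j : Fin d, (Pi.single i 1 : Fin d → ℤ) ≠ -Pi.single j 1 := by
    intro i j h
    have := congrFun h i
    simp only [Pi.single_eq_same, Pi.neg_apply, Pi.single_apply] at this
    split_ifs at this
    all_goals omega
  have hinj : ∀ i j : Fin d, (Pi.single i 1 : Fin d → ℤ) = Pi.single j 1 ↔ i = j := by
    intro i j
    refine ⟨fun h => ?_, fun h => by rw [h]⟩
    by_contra hij
    have := congrFun h i
    simp [Pi.single_eq_of_ne hij] at this
  have h1 : ∀ j : Fin d, n + Pi.single j 1 = m ↔ m - n = Pi.single j 1 := fun j => by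
    rw [sub_eq_iff_eq_add', eq_comm]
  have h2 : ∀ j : Fin d, n - Pi.single j 1 = m ↔ m - n = -Pi.single j 1 := fun j =>
    ⟨fun h => by linear_combination -h, fun h => by linear_combination -h⟩
  have h3 : ∑ i, |n i - m i| = ∑ i, |(m - n) i| :=
    Finset.sum_congr rfl fun i _ => abs_sub_comm _ _
  simp only [h1, h2, h3]
  generalize m - n = k
  split_ifs with hk
  · obtain ⟨j, rfl | rfl⟩ := exists_eq_single_of_sum_abs_eq_one hk
    · simp [hne, hinj]
    · simp [neg_inj, hinj, (hne _ _).symm]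
  · refine Finset.sum_eq_zero fun j _ => ?_
    rw [if_neg, if_neg, add_zero]
    · rintro rfl
      exact hk (by simpa using sum_abs_single j)
    · rintro rfl
      exact hk (sum_abs_single j)

theorem boxHamiltonian_apply (V : (Fin d → ℤ) → ℝ) (L : ℕ) (n m : latticeBox d L) :
    boxHamiltonian V L n m
      = -∑ j : Fin d, ((if n.1 + Pi.single j 1 = m.1 then (1 : ℂ) else 0)
        + (if n.1 - Pi.single j 1 = m.1 then 1 else 0))
        + (if n.1 = m.1 then (V n.1 : ℂ) else 0) := by
  rw [sum_neighbours]
  simp only [boxHamiltonian, Matrix.of_apply, Subtype.ext_iff]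
  congr 1
  split_ifs <;> simp

theorem isHermitian_boxHamiltonian (V : (Fin d → ℤ) → ℝ) (L : ℕ) :
    (boxHamiltonian V L).IsHermitian := by
  ext n m
  have h : ∑ i, |m.1 i - n.1 i| = ∑ i, |n.1 i - m.1 i| :=
    Finset.sum_congr rfl fun i _ => abs_sub_comm _ _
  simp only [Matrix.conjTranspose_apply, boxHamiltonian, Matrix.of_apply, h]
  by_cases hnm : n = m
  · subst hnm; simp
  · rw [if_neg (Ne.symm hnm), if_neg hnm]
    split_ifs <;> simp

/-- Extension by zero of a function on the box `Λ_L`. -/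
def extendBox (L : ℕ) (w : latticeBox d L → ℂ) (z : Fin d → ℤ) : ℂ :=
  if h : z ∈ latticeBox d L then w ⟨z, h⟩ else 0

theorem sum_ite_eq_extendBox (L : ℕ) (w : latticeBox d L → ℂ) (a : Fin d → ℤ) (c : ℂ) :
    ∑ z : latticeBox d L, (if a = z.1 then c else 0) * w z = c * extendBox L w a := by
  unfold extendBox
  split_ifs with h
  · rw [Finset.sum_eq_single ⟨a, h⟩] <;> simp +contextual [Subtype.ext_iff, eq_comm]
  · rw [mul_zero]
    refine Finset.sum_eq_zero fun z _ => ?_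
    rw [if_neg, zero_mul]
    rintro rfl
    exact h z.2

/-- The box matrix acts as the lattice operator on the extension by zero. -/
theorem boxHamiltonian_mulVec (V : (Fin d → ℤ) → ℝ) (L : ℕ) (w : latticeBox d L → ℂ)
    (n : latticeBox d L) :
    ∑ z, boxHamiltonian V L n z * w z
      = -∑ j : Fin d, (extendBox L w (n.1 + Pi.single j 1) + extendBox L w (n.1 - Pi.single j 1))
        + V n.1 * extendBox L w n.1 := by
  simp only [boxHamiltonian_apply, add_mul, neg_mul, Finset.sum_mul, Finset.sum_add_distrib,
    Finset.sum_neg_distrib, sum_ite_eq_extendBox]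
  rw [Finset.sum_comm,
    Finset.sum_comm (f := fun z j => (if n.1 - _ = z.1 then (1 : ℂ) else 0) * w z)]
  simp only [sum_ite_eq_extendBox, one_mul]

theorem eventually_mem_latticeBox (z : Fin d → ℤ) : ∀ᶠ L : ℕ in atTop, z ∈ latticeBox d L := by
  filter_upwards [eventually_ge_atTop (∑ i, (z i).natAbs)] with L hL
  rw [latticeBox, Finset.mem_Icc, Pi.le_def, Pi.le_def]
  have h : ∀ i, (z i).natAbs ≤ L := fun i =>
    (Finset.single_le_sum (f := fun i => (z i).natAbs) (fun _ _ => Nat.zero_le _)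
      (Finset.mem_univ i)).trans hL
  exact ⟨fun i => by have := h i; omega, fun i => by have := h i; omega⟩

theorem inner_basisVec_left (x : Fin d → ℤ) (v : LatticeL2 d) : inner ℂ (basisVec x) v = v x := by
  rw [basisVec, lp.inner_single_left]
  simp

theorem basisVec_apply (x z : Fin d → ℤ) : basisVec x z = if x = z then (1 : ℂ) else 0 := by
  rw [basisVec, lp.single_apply]
  by_cases h : x = z
  · subst h; simp
  · simp [h, Ne.symm h]

theorem norm_basisVec (x : Fin d → ℤ) : ‖basisVec x‖ = 1 := by
  rw [basisVec, lp.norm_single (by norm_num)]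
  simp

variable {V : (Fin d → ℤ) → ℝ} {M : ℝ}

/-- Hopping is to nearest neighbours, so k steps from y do not feel the boundary of a large box: the
entries agree exactly, not only in the limit. -/
theorem eventually_boxHamiltonian_pow (hM : ∀ n, |V n| ≤ M) (y : Fin d → ℤ) (k : ℕ) :
    ∀ x, ∀ᶠ L : ℕ in atTop, ∀ hy : y ∈ latticeBox d L,
      extendBox L (fun z => (boxHamiltonian V L ^ k) z ⟨y, hy⟩) x
        = ((andersonOp V ^ k) (basisVec y) : LatticeL2 d) x := by
  induction k with
  | zero =>
    intro x
    filter_upwards [eventually_mem_latticeBox x] with L hx hy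
    rw [extendBox, dif_pos hx, pow_zero, pow_zero, Matrix.one_apply]
    simp [basisVec_apply, eq_comm]
  | succ k ih =>
    intro x
    have h1 := eventually_all.2 fun j : Fin d => ih (x + Pi.single j 1)
    have h2 := eventually_all.2 fun j : Fin d => ih (x - Pi.single j 1)
    filter_upwards [eventually_mem_latticeBox x, h1, h2, ih x] with L hx h1 h2 h3 hy
    rw [pow_succ' (andersonOp V), mul_apply_eq_comp, andersonOp_apply V M hM,
      extendBox, dif_pos hx, pow_succ', Matrix.mul_apply, boxHamiltonian_mulVec, h3 hy]
    simp only [fun j => h1 j hy, fun j => h2 j hy]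

theorem eventually_boxHamiltonian_aeval (hM : ∀ n, |V n| ≤ M) (x y : Fin d → ℤ)
    (p : Polynomial ℝ) :
    ∀ᶠ L : ℕ in atTop, ∀ (hx : x ∈ latticeBox d L) (hy : y ∈ latticeBox d L),
      (Polynomial.aeval (boxHamiltonian V L) p) ⟨x, hx⟩ ⟨y, hy⟩
        = inner ℂ (basisVec x) (Polynomial.aeval (andersonOp V) p (basisVec y)) := by
  have h := (Finset.range (p.natDegree + 1)).eventually_all.2 fun k _ =>
    eventually_boxHamiltonian_pow hM y k x
  filter_upwards [h] with L h hx hy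
  rw [inner_basisVec_left, Polynomial.aeval_eq_sum_range, Polynomial.aeval_eq_sum_range,
    Matrix.sum_apply, sum_apply, lp.coeFn_sum, Finset.sum_apply]
  refine Finset.sum_congr rfl fun k hk => ?_
  have := h k hk hy
  rw [extendBox, dif_pos hx] at this
  rw [Matrix.smul_apply, this]
  rfl

theorem boxHamiltonian_eq_inner (hM : ∀ n, |V n| ≤ M) (L : ℕ) (n m : latticeBox d L) :
    boxHamiltonian V L n m = inner ℂ (basisVec n.1) (andersonOp V (basisVec m.1)) := by
  rw [inner_basisVec_left, andersonOp_apply V M hM, boxHamiltonian_apply]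
  simp only [basisVec_apply, eq_comm (a := m.1)]
  simp

/-- The eigenvalue is the quadratic form of the full operator at the eigenvector extended by zero.
The bound is uniform in L, so one polynomial approximation serves all boxes. -/
theorem abs_eigenvalues_boxHamiltonian_le (hM : ∀ n, |V n| ≤ M) (L : ℕ) (k : latticeBox d L) :
    |(isHermitian_boxHamiltonian V L).eigenvalues k| ≤ ‖andersonOp V‖ := by
  set hA := isHermitian_boxHamiltonian V L
  set ψ := hA.eigenvectorBasis k with hψ
  set u : LatticeL2 d := ∑ z : latticeBox d L, ψ z • basisVec z.1 with hu
  have huu : inner ℂ u u = (1 : ℂ) := by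
    have h1 : inner ℂ ψ ψ = (1 : ℂ) := by
      rw [inner_self_eq_norm_sq_to_K, hA.eigenvectorBasis.orthonormal.1 k]; simp
    rw [← h1, PiLp.inner_apply, hu]
    simp only [sum_inner, inner_sum, inner_smul_left, inner_smul_right, inner_basisVec_left,
      basisVec_apply, ← Subtype.ext_iff]
    simp [Complex.mul_conj, Complex.normSq_eq_norm_sq]
  have hnorm : ‖u‖ = 1 := by
    have := inner_self_eq_norm_sq_to_K (𝕜 := ℂ) u
    rw [huu] at this
    have h2 : ‖u‖ ^ 2 = 1 := by
      rw [← Complex.ofReal_inj]; push_cast; exact this.symm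
    nlinarith [norm_nonneg u]
  have hE : inner ℂ u (andersonOp V u) = (hA.eigenvalues k : ℂ) := by
    have h1 : inner ℂ ψ ψ = (1 : ℂ) := by
      rw [inner_self_eq_norm_sq_to_K, hA.eigenvectorBasis.orthonormal.1 k]; simp
    have h2 : ∀ z, ∑ w, boxHamiltonian V L z w * ψ w = hA.eigenvalues k * ψ z := by
      intro z
      have := congrFun (hA.mulVec_eigenvectorBasis k) z
      simpa [Matrix.mulVec, dotProduct] using this
    have h3 : ∀ z, ∑ w : latticeBox d L, ψ w * inner ℂ (basisVec z.1) (andersonOp V (basisVec w.1))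
        = hA.eigenvalues k * ψ z := by
      intro z
      rw [← h2]
      exact Finset.sum_congr rfl fun w _ => by rw [boxHamiltonian_eq_inner hM, mul_comm]
    rw [← mul_one (hA.eigenvalues k : ℂ), ← h1, PiLp.inner_apply, hu]
    simp only [map_sum, map_smul, sum_inner, inner_sum, inner_smul_left, inner_smul_right]
    simp only [Finset.mul_sum]
    rw [Finset.sum_comm]
    refine Finset.sum_congr rfl fun z _ => ?_
    have h4 : ∑ w : latticeBox d L, ψ w * (starRingEnd ℂ (ψ z) *
        inner ℂ (basisVec z.1) (andersonOp V (basisVec w.1)))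
        = starRingEnd ℂ (ψ z) * (hA.eigenvalues k * ψ z) := by
      rw [← h3, Finset.mul_sum]
      exact Finset.sum_congr rfl fun w _ => by ring
    rw [h4, RCLike.inner_apply]
    ring
  calc |hA.eigenvalues k| = ‖(hA.eigenvalues k : ℂ)‖ := by rw [Complex.norm_real]; rfl
    _ = ‖inner ℂ u (andersonOp V u)‖ := by rw [hE]
    _ ≤ ‖u‖ * (‖andersonOp V‖ * ‖u‖) :=
        (norm_inner_le_norm _ _).trans (by gcongr; exact ContinuousLinearMap.le_opNorm _ _)
    _ = ‖andersonOp V‖ := by rw [hnorm]; ring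

open Classical in
/-- The matrix element `⟨e_x, f(h^{Λ_L}) e_y⟩`, set to `0` unless `x, y ∈ Λ_L`. -/
def boxFun (V : (Fin d → ℤ) → ℝ) (L : ℕ) (f : C(ℝ, ℝ)) (x y : Fin d → ℤ) : ℂ :=
  if h : x ∈ latticeBox d L ∧ y ∈ latticeBox d L then
    HermitianMatrix.funCalc (isHermitian_boxHamiltonian V L) (fun t => (f t : ℂ)) ⟨x, h.1⟩ ⟨y, h.2⟩
  else 0

theorem tendsto_boxFun (hM : ∀ n, |V n| ≤ M) (f : C(ℝ, ℝ)) (x y : Fin d → ℤ) :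
    Tendsto (fun L => boxFun V L f x y) atTop
      (𝓝 (funElement (andersonOp V) (basisVec x) (basisVec y) f)) := by
  rw [Metric.tendsto_nhds]
  intro ε hε
  -- R exceeds both the bound on box eigenvalues and the bound on the spectrum of the full operator.
  set R : ℝ := ‖andersonOp V‖ + ‖andersonOp V‖ * ‖(1 : LatticeL2 d →L[ℂ] LatticeL2 d)‖
  obtain ⟨p, hp⟩ := exists_polynomial_near_of_continuousOn (-R) R f f.continuous.continuousOn
    (ε / 3) (by positivity)
  have hinf := norm_inner_aeval_sub_funElement_le (isSelfAdjoint_andersonOp V) (basisVec x)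
    (basisVec y) f p (R := R) (le_add_of_nonneg_left (norm_nonneg _)) (by positivity)
    fun t ht => (hp t ht).le
  rw [norm_basisVec, norm_basisVec, one_mul, mul_one] at hinf
  filter_upwards [eventually_mem_latticeBox x, eventually_mem_latticeBox y,
    eventually_boxHamiltonian_aeval hM x y p] with L hx hy hpoly
  rw [boxFun, dif_pos ⟨hx, hy⟩, dist_eq_norm]
  have hfin := HermitianMatrix.norm_funCalc_sub_le (isHermitian_boxHamiltonian V L)
    (fun t => (f t : ℂ)) (fun t => ((p.eval t : ℝ) : ℂ)) (ε / 3) (fun k => by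
      rw [← Complex.ofReal_sub, Complex.norm_real, norm_sub_rev]
      refine (hp _ ?_).le
      rw [Set.mem_Icc, ← abs_le]
      exact (abs_eigenvalues_boxHamiltonian_le hM L k).trans
        (le_add_of_nonneg_right (by positivity))) ⟨x, hx⟩ ⟨y, hy⟩
  rw [HermitianMatrix.funCalc_polynomial, hpoly hx hy] at hfin
  have := norm_sub_le_norm_sub_add_norm_sub
    (HermitianMatrix.funCalc (isHermitian_boxHamiltonian V L) (fun t => (f t : ℂ)) ⟨x, hx⟩ ⟨y, hy⟩)
    (inner ℂ (basisVec x) (Polynomial.aeval (andersonOp V) p (basisVec y)))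
    (funElement (andersonOp V) (basisVec x) (basisVec y) f)
  exact (this.trans (add_le_add hfin hinf)).trans_lt (by linarith)

end InfiniteVolume

/-! ### Box matrix elements against the correlator. -/

section Correlator

open HermitianMatrix

/-- At each energy at most one F_i is nonzero, so ∑ |F_i| is at most the indicator of U. -/
theorem sum_enorm_funCalc_le_eigenCorr {ι : Type*} [Fintype ι] [DecidableEq ι] {A : Matrix ι ι ℂ}
    (hA : A.IsHermitian) {U : Set ℝ} {n : ℕ} {F : Fin n → C(ℝ, ℝ)} (hF : F ∈ testFamilies U n)
    (x y : ι) :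
    ∑ i, ‖funCalc hA (fun t => (F i t : ℂ)) x y‖ₑ ≤ eigenCorr hA U x y := by
  obtain ⟨hF1, hF2, hF3⟩ := hF
  have hsum : ∀ t, ∑ i, ‖(F i t : ℂ)‖ₑ ≤ U.indicator 1 t := by
    intro t
    by_cases h : ∃ i, F i t ≠ 0
    · obtain ⟨i, hi⟩ := h
      have hU : t ∈ U := by
        by_contra hU
        exact hi (hF2 i t hU)
      rw [Set.indicator_of_mem hU, Finset.sum_eq_single i]
      · rw [← ofReal_norm, Complex.norm_real, Real.norm_of_nonneg (hF1 i t).1]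
        exact ENNReal.ofReal_le_one.2 (hF1 i t).2
      · intro j _ hj
        rw [(hF3 j i hj t).resolve_right hi]; simp
      · simp
    · push Not at h
      simp [h]
  calc ∑ i, ‖funCalc hA (fun t => (F i t : ℂ)) x y‖ₑ
      ≤ ∑ i, ∑ k, ‖(F i (hA.eigenvalues k) : ℂ)‖ₑ *
          (‖hA.eigenvectorBasis k x‖ₑ * ‖hA.eigenvectorBasis k y‖ₑ) := by
        refine Finset.sum_le_sum fun i _ => ?_
        rw [funCalc_apply]
        refine (enorm_sum_le _ _).trans (le_of_eq (Finset.sum_congr rfl fun k _ => ?_))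
        rw [enorm_mul, enorm_mul, ← ofReal_norm (star _), norm_star, ofReal_norm]
    _ = ∑ k, (∑ i, ‖(F i (hA.eigenvalues k) : ℂ)‖ₑ) *
          (‖hA.eigenvectorBasis k x‖ₑ * ‖hA.eigenvectorBasis k y‖ₑ) := by
        rw [Finset.sum_comm]
        simp only [Finset.sum_mul]
    _ ≤ eigenCorr hA U x y := by
        refine Finset.sum_le_sum fun k _ => ?_
        gcongr
        exact hsum _

theorem funCalc_congr {ι : Type*} [Fintype ι] [DecidableEq ι] {A B : Matrix ι ι ℂ}
    (hA : A.IsHermitian) (hB : B.IsHermitian) (h : A = B) (f : ℝ → ℂ) :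
    funCalc hA f = funCalc hB f := by
  subst h; rfl

variable {d : ℕ}

theorem boxHamiltonian_eq_addPotential (V : (Fin d → ℤ) → ℝ) (L : ℕ) :
    boxHamiltonian V L
      = addPotential (boxHamiltonian (fun _ : Fin d → ℤ => 0) L) fun n => V n.1 := by
  ext n m
  simp [boxHamiltonian, addPotential, Matrix.diagonal_apply]

end Correlator

/-! ### Constants N and M from the single-site density. -/

section Density

variable {ρ : ℝ → ℝ}

theorem IsBoundedCompactDensity.exists_withDensity_le (hρ : IsBoundedCompactDensity ρ) :
    ∃ N : ℝ≥0, (volume.withDensity fun v => ENNReal.ofReal (ρ v)) ≤ N • volume := by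
  obtain ⟨N, hN⟩ : ∃ N : ℝ≥0, ∀ᵐ v, ‖ρ v‖ ≤ N := by
    refine ⟨(eLpNorm ρ ∞ volume).toNNReal, ?_⟩
    filter_upwards [ae_le_eLpNormEssSup (f := ρ) (μ := volume)] with v hv
    rw [← eLpNorm_exponent_top] at hv
    have := ENNReal.toNNReal_mono hρ.memLp_top.eLpNorm_ne_top hv
    simpa using NNReal.coe_le_coe.2 this
  refine ⟨N, ?_⟩
  have h : (volume : Measure ℝ).withDensity (fun _ => (N : ℝ≥0∞)) = N • volume := by
    rw [withDensity_const]; rfl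
  rw [← h]
  refine withDensity_mono ?_
  filter_upwards [hN] with v hv
  rw [← ENNReal.ofReal_coe_nnreal]
  exact ENNReal.ofReal_le_ofReal ((le_abs_self _).trans hv)

theorem IsBoundedCompactDensity.exists_ae_abs_le (hρ : IsBoundedCompactDensity ρ) :
    ∃ M : ℝ, ∀ᵐ v ∂(volume.withDensity fun v => ENNReal.ofReal (ρ v)), |v| ≤ M := by
  obtain ⟨K, hK, hKρ⟩ := hρ.compact_support
  obtain ⟨M, hM⟩ := hK.isBounded.exists_norm_le
  refine ⟨M, ?_⟩
  have hm : AEMeasurable (fun v => ENNReal.ofReal (ρ v)) volume :=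
    hρ.memLp_top.aestronglyMeasurable.aemeasurable.ennreal_ofReal
  rw [ae_withDensity_iff' hm]
  filter_upwards [hKρ] with v hv h0
  by_contra hvM
  have : v ∉ K := fun hvK => hvM (hM v hvK)
  rw [hv this] at h0
  simp at h0

end Density

/-! ### The random box Hamiltonian. -/

section Random

open HermitianMatrix

variable {d : ℕ} {Ω : Type*} [MeasurableSpace Ω] {P : Measure Ω} [IsProbabilityMeasure P]
  {ω : (Fin d → ℤ) → Ω → ℝ} {ρ : ℝ → ℝ}

theorem IsIIDPotential.map_box (h : IsIIDPotential P ω ρ) (L : ℕ) :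
    P.map (fun t (n : latticeBox d L) => ω n.1 t)
      = Measure.pi fun _ => volume.withDensity fun v => ENNReal.ofReal (ρ v) := by
  have h1 := h.indep.precomp (g := fun n : latticeBox d L => n.1) Subtype.val_injective
  have h2 := (iIndepFun_iff_map_fun_eq_pi_map fun n : latticeBox d L =>
    (h.measurable n.1).aemeasurable).1 h1
  rw [h2]
  simp only [h.law]

omit [IsProbabilityMeasure P] in
theorem IsIIDPotential.ae_bounded (h : IsIIDPotential P ω ρ) {M : ℝ}
    (hM : ∀ᵐ v ∂(volume.withDensity fun v => ENNReal.ofReal (ρ v)), |v| ≤ M) :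
    ∀ᵐ t ∂P, ∀ n, |ω n t| ≤ M := by
  refine ae_all_iff.2 fun n => ?_
  rw [← h.law n] at hM
  exact ae_of_ae_map (h.measurable n).aemeasurable hM

theorem measurable_boxHamiltonian (hω : ∀ n, Measurable (ω n)) (L : ℕ) (n m : latticeBox d L) :
    Measurable fun t => boxHamiltonian (fun n => ω n t) L n m := by
  simp only [boxHamiltonian, Matrix.of_apply]
  refine measurable_const.add ?_
  split_ifs
  · exact Complex.measurable_ofReal.comp (hω _)
  · exact measurable_const

theorem measurable_boxFun (hω : ∀ n, Measurable (ω n)) (L : ℕ) (f : C(ℝ, ℝ)) (x y : Fin d → ℤ) :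
    Measurable fun t => boxFun (fun n => ω n t) L f x y := by
  unfold boxFun
  split_ifs with h
  · exact measurable_funCalc (measurable_boxHamiltonian hω L)
      (fun t => isHermitian_boxHamiltonian _ L) f.continuous _ _
  · exact measurable_const

theorem lintegral_boxFun_le (h : IsIIDPotential P ω ρ) {s : ℝ} (hs0 : 0 < s) (hs1 : s < 1)
    {M : ℝ} {N : ℝ≥0} (hM : ∀ᵐ v ∂(volume.withDensity fun v => ENNReal.ofReal (ρ v)), |v| ≤ M)
    (hN : (volume.withDensity fun v => ENNReal.ofReal (ρ v)) ≤ N • volume)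
    {U : Set ℝ} (hU : MeasurableSet U) {𝓕 : Set (Σ n, Fin n → C(ℝ, ℝ))} (h𝓕 : 𝓕.Countable)
    (hF : ∀ F ∈ 𝓕, F.2 ∈ testFamilies U F.1) {L : ℕ} {x y : Fin d → ℤ}
    (hx : x ∈ latticeBox d L) (hy : y ∈ latticeBox d L) :
    ∫⁻ t, ⨆ F ∈ 𝓕, ∑ i, ‖boxFun (fun n => ω n t) L (F.2 i) x y‖ₑ ∂P
      ≤ (N * ENNReal.ofReal (2 * M) ^ s) ^ (1 / (2 - s)) *
        (∫⁻ E in U, ∫⁻ t, ‖boxGreen (fun n => ω n t) L x y E‖ₑ ^ s ∂P) ^ (1 / (2 - s)) := by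
  set κ := volume.withDensity fun v => ENNReal.ofReal (ρ v) with hκ
  have : IsProbabilityMeasure κ := by
    rw [hκ, ← h.law 0]; exact Measure.isProbabilityMeasure_map (h.measurable 0).aemeasurable
  set K := boxHamiltonian (fun _ : Fin d → ℤ => 0) L
  have hK : K.IsHermitian := isHermitian_boxHamiltonian _ L
  -- This countable supremum lies below the correlator and is measurable without measurable
  -- eigenvectors.
  set G : (latticeBox d L → ℝ) → ℝ≥0∞ := fun W => ⨆ F ∈ 𝓕, ∑ i,
    ‖funCalc (isHermitian_addPotential hK W) (fun t => (F.2 i t : ℂ)) ⟨x, hx⟩ ⟨y, hy⟩‖ₑ with hG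
  have hGm : Measurable G := by
    refine Measurable.biSup _ h𝓕 fun F _ => Finset.measurable_sum _ fun i _ => ?_
    exact (measurable_funCalc (measurable_addPotential K)
      (fun W => isHermitian_addPotential hK W) (F.2 i).continuous _ _).enorm
  have hGle : ∀ W, G W ≤ eigenCorr (isHermitian_addPotential hK W) U ⟨x, hx⟩ ⟨y, hy⟩ := fun W =>
    iSup₂_le fun F hFm => sum_enorm_funCalc_le_eigenCorr _ (hF F hFm) _ _
  have hres : Measurable fun t (n : latticeBox d L) => ω n.1 t :=
    measurable_pi_lambda _ fun n => h.measurable n.1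
  have hl : ∫⁻ t, ⨆ F ∈ 𝓕, ∑ i, ‖boxFun (fun n => ω n t) L (F.2 i) x y‖ₑ ∂P
      = ∫⁻ W, G W ∂Measure.pi fun _ => κ := by
    rw [← h.map_box L, lintegral_map hGm hres]
    refine lintegral_congr fun t => ?_
    simp only [hG, boxFun, dif_pos (And.intro hx hy)]
    refine iSup_congr fun F => iSup_congr fun _ => Finset.sum_congr rfl fun i _ => ?_
    rw [funCalc_congr (isHermitian_boxHamiltonian _ L) (isHermitian_addPotential hK _)
      (boxHamiltonian_eq_addPotential _ L)]
  have hr : ∀ E : ℝ, ∫⁻ t, ‖boxGreen (fun n => ω n t) L x y E‖ₑ ^ s ∂P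
      = ∫⁻ W, ‖(addPotential K W - (E : ℂ) • (1 : Matrix (latticeBox d L) (latticeBox d L) ℂ))⁻¹
        ⟨x, hx⟩ ⟨y, hy⟩‖ₑ ^ s
        ∂Measure.pi fun _ => κ := by
    intro E
    rw [← h.map_box L, lintegral_map _ hres]
    · refine lintegral_congr fun t => ?_
      rw [boxGreen, dif_pos ⟨hx, hy⟩, boxHamiltonian_eq_addPotential]
    · exact ((measurable_green K _ _).comp (measurable_id.prodMk measurable_const)).pow_const s
  rw [hl]
  simp only [hr]
  exact lintegral_le_green hs0 hs1 hK hU _ _ hM hN hGm hGle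

end Random
end

/-! ### Passage to infinite volume. -/

theorem proposition6p1 (d : ℕ) (hd : 1 ≤ d) (s : ℝ) (hs0 : 0 < s) (hs1 : s < 1)
    (ρ : ℝ → ℝ) (hρ : IsBoundedCompactDensity ρ) :
    ∃ C : ℝ≥0, ∀ (Ω : Type*) [MeasurableSpace Ω] (P : Measure Ω) [IsProbabilityMeasure P]
      (ω : (Fin d → ℤ) → Ω → ℝ), IsIIDPotential P ω ρ →
      ∀ (a b : ℝ) (x y : Fin d → ℤ),
        AEMeasurable (fun t : Ω =>
          (mixedSpectralMeasure (andersonOp fun n => ω n t) (basisVec x) (basisVec y)).variation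
            (Set.Ioo a b)) P ∧
        ∫⁻ t, (mixedSpectralMeasure (andersonOp fun n => ω n t)
            (basisVec x) (basisVec y)).variation (Set.Ioo a b) ∂P
          ≤ C * liminf (fun L : ℕ =>
              (∫⁻ E in Set.Ioo a b,
                ∫⁻ t, ‖boxGreen (fun n => ω n t) L x y E‖ₑ ^ s ∂P) ^ (1 / (2 - s))) atTop := by
  obtain ⟨N, hN⟩ := hρ.exists_withDensity_le
  obtain ⟨M, hM⟩ := hρ.exists_ae_abs_le
  have hp : 0 ≤ 1 / (2 - s) := one_div_nonneg.2 (by linarith)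
  have hCtop : ((N : ℝ≥0∞) * ENNReal.ofReal (2 * M) ^ s) ^ (1 / (2 - s)) ≠ ∞ := by finiteness
  refine ⟨(((N : ℝ≥0∞) * ENNReal.ofReal (2 * M) ^ s) ^ (1 / (2 - s))).toNNReal, ?_⟩
  intro Ω _ P _ ω h a b x y
  obtain ⟨𝓕, h𝓕, hF, hvar⟩ := exists_countable_variation_eq_iSup (H := LatticeL2 d) a b
  set c : (Σ n, Fin n → C(ℝ, ℝ)) → ℕ → Ω → ℝ≥0∞ := fun F L t =>
    ∑ i, ‖boxFun (fun n => ω n t) L (F.2 i) x y‖ₑ with hc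
  have hcm : ∀ F L, Measurable (c F L) := fun F L =>
    Finset.measurable_sum _ fun i _ => (measurable_boxFun h.measurable L (F.2 i) x y).enorm
  -- Almost surely the potential is bounded and the box quantities converge. Writing the limit as a
  -- liminf gives a function measurable everywhere.
  have hae : ∀ᵐ t ∂P, (mixedSpectralMeasure (andersonOp fun n => ω n t) (basisVec x)
      (basisVec y)).variation (Set.Ioo a b) = ⨆ F ∈ 𝓕, liminf (fun L => c F L t) atTop := by
    filter_upwards [h.ae_bounded hM] with t ht
    rw [hvar]
    refine iSup_congr fun F => iSup_congr fun _ => Eq.symm (Tendsto.liminf_eq ?_)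
    exact tendsto_finsetSum _ fun i _ =>
      (continuous_enorm.tendsto _).comp (tendsto_boxFun ht (F.2 i) x y)
  refine ⟨⟨fun t => ⨆ F ∈ 𝓕, liminf (fun L => c F L t) atTop,
    Measurable.biSup _ h𝓕 fun F _ => Measurable.liminf fun L => hcm F L, hae⟩, ?_⟩
  rw [ENNReal.coe_toNNReal hCtop, ← ENNReal.liminf_const_mul_of_ne_top hCtop]
  calc ∫⁻ t, (mixedSpectralMeasure (andersonOp fun n => ω n t)
            (basisVec x) (basisVec y)).variation (Set.Ioo a b) ∂P
      = ∫⁻ t, ⨆ F ∈ 𝓕, liminf (fun L => c F L t) atTop ∂P := lintegral_congr_ae hae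
    _ ≤ ∫⁻ t, liminf (fun L => ⨆ F ∈ 𝓕, c F L t) atTop ∂P := by
        refine lintegral_mono fun t => iSup₂_le fun F hFm => ?_
        exact liminf_le_liminf (Eventually.of_forall fun L =>
          le_iSup₂ (f := fun F (_ : F ∈ 𝓕) => c F L t) F hFm)
    _ ≤ liminf (fun L => ∫⁻ t, ⨆ F ∈ 𝓕, c F L t ∂P) atTop :=
        lintegral_liminf_le fun L => Measurable.biSup _ h𝓕 fun F _ => hcm F L
    _ ≤ _ := by
        refine liminf_le_liminf ?_
        -- Small boxes missing x or y, where the Green function is 0 by convention, do not affect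
        -- the liminf.
        filter_upwards [eventually_mem_latticeBox x, eventually_mem_latticeBox y] with L hx hy
        exact lintegral_boxFun_le h hs0 hs1 hM hN measurableSet_Ioo h𝓕 hF hx hy
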